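/- Let $m\ge 4$ and $n\ge 6$ be even integers, $n=2n'$, and let $k,\ell\in\mathbb{Z}_n$ with $k$ odd and $\ell$ even. Let $\mathcal{X}_a(m,n,k,\ell)$ be the graph with vertices $u_{i,j}$, $i\in\mathbb{Z}_m$, $j\in\mathbb{Z}_n$, whose edges are - the *links* $u_{i,j}u_{i+1,j}$ for $0\le i\le m-2$ and $j\equiv i \pmod 2$, and $u_{m-1,j}u_{0,j+\ell}$ for $j\equiv m-1\pmod 2$; - the *non-links* $u_{i,j}u_{i,j\pm k_i}$ for all $i,j$, where $k_i=1$ for even $i$ and $k_i=k$ for odd $i$. Let $C_i$ be the subgraph induced on $\{u_{i,j} : j\in\mathbb{Z}_n\}$ and $\mathcal{C}=\{C_i : i\in\mathbb{Z}_m\}$. Call $(m,n,k,\ell)$ *admissible* if (in $\mathbb{Z}_n$) $2k\ne\pm2$, $2k^2=\pm2$ and one of the following holds: - $\ell k=\pm\ell$, and $k^2=\pm1$ or $4\mid m$; - $\ell k=n'\pm\ell$, $m\equiv2\pmod 4$ and $k^2=n'\pm1$. (For admissible parameters the $C_i$ are cycles of length $n$ and $\mathcal{C}$ is a $2$-factor.)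 A $10$-cycle of $\mathcal{X}_a(m,n,k,\ell)$ is *of type $3$* if, traversed from a suitable vertex in a suitable direction, its edges are in turn three non-links, a link, a non-link, a link, a non-link, a link, a non-link, a link. For fixed $m,n$, consider the following changes of the pair $(k,\ell)$: $(k,\ell)\mapsto(-k,\ell)$; $(k,\ell)\mapsto(k,-\ell)$; and, if $4\mid n$, $(k,\ell)\mapsto(k+n',\ell)$ when $4\mid m$ and $(k,\ell)\mapsto(k+n',\ell+n')$ when $4\nmid m$. (For admissible parameters these changes preserve the isomorphism class of the graph.) **Proposition.** Let $(m,n,k,\ell)$ be admissible with $n\ge14$ and $4k=\pm4$ in $\mathbb{Z}_n$, and let $\Gamma=\mathcal{X}_a(m,n,k,\ell)$. Suppose that $\Gamma$ has a $10$-cycle of type $3$ and that $\mathcal{C}$ is not preserved by $\mathrm{Aut}(\Gamma)$. Then $m=4$ and there is an integer $n_0\ge1$ such that - $n=16n_0$, the pair $(k,\ell)$ can be transformed by finitely many of the above changes into $(4n_0+1,\,8n_0+4)$, and $\Gamma\cong\mathcal{X}_a(4,16n_0,4n_0+1,8n_0+4)$; or - $n=32n_0$, the pair $(k,\ell)$ can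 be transformed by finitely many of the above changes into $(8n_0+1,\,4)$, and $\Gamma\cong\mathcal{X}_a(4,32n_0,8n_0+1,4)$. -/

import Mathlib

namespace Xa

/-- The vertices `u_{i,j}`, with `i` in `ℤ_m` and `j` in `ℤ_n`. -/
abbrev Vertex (m n : ℕ) : Type := ZMod m × ZMod n

/-- The signature `[1, k, 1, k, …, 1, k]`. -/
def signature (m n : ℕ) (k : ZMod n) (i : ZMod m) : ZMod n :=
  if Even i.val then 1 else k

/-- The links, each of them written in one direction:
`u_{i,j} ∼ u_{i+1,j}` for `0 ≤ i ≤ m - 2` and `j ≡ i (mod 2)`, and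
`u_{m-1,j} ∼ u_{0,j+ℓ}` for `j ≡ m - 1 (mod 2)`.
Since `n` is even in all uses, the parity of an element of `ℤ_n` is that of its
representative `ZMod.val`. -/
def LinkRel (m n : ℕ) (ℓ : ZMod n) (u v : Vertex m n) : Prop :=
  u.2.val ≡ u.1.val [MOD 2] ∧
    ((u.1.val + 1 < m ∧ v = (u.1 + 1, u.2)) ∨
      (u.1.val + 1 = m ∧ v = (0, u.2 + ℓ)))

/-- The 1-factor `I` formed by the links. -/
def linkGraph (m n : ℕ) (ℓ : ZMod n) : SimpleGraph (Vertex m n) :=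
  SimpleGraph.fromRel (LinkRel m n ℓ)

/-- The graph formed by the non-links `u_{i,j} ∼ u_{i,j ± k_i}`, where `k_i` is the `i`-th entry
of the signature. -/
def nonLinkGraph (m n : ℕ) (k : ZMod n) : SimpleGraph (Vertex m n) :=
  SimpleGraph.fromRel fun u v => v = (u.1, u.2 + signature m n k u.1)

/-- The graph `X_a(m, n, k, ℓ)`. -/
def graph (m n : ℕ) (k ℓ : ZMod n) : SimpleGraph (Vertex m n) :=
  linkGraph m n ℓ ⊔ nonLinkGraph m n k

/-- The cycle `C_i`: the subgraph induced on `V_i = {u_{i,j} : j ∈ ℤ_n}`. -/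
def cycleAt (m n : ℕ) (k ℓ : ZMod n) (i : ZMod m) : (graph m n k ℓ).Subgraph :=
  (⊤ : (graph m n k ℓ).Subgraph).induce {v | v.1 = i}

/-- The 2-factor `𝒞 = {C_i : i ∈ ℤ_m}`. -/
def twoFactor (m n : ℕ) (k ℓ : ZMod n) : Set (graph m n k ℓ).Subgraph :=
  Set.range (cycleAt m n k ℓ)

/-- Every automorphism of the graph maps the 2-factor `𝒞` to itself. -/
def TwoFactorAutInvariant (m n : ℕ) (k ℓ : ZMod n) : Prop :=
  ∀ φ : graph m n k ℓ ≃g graph m n k ℓ,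
    (fun C => SimpleGraph.Subgraph.map φ.toHom C) '' twoFactor m n k ℓ = twoFactor m n k ℓ

/-- `v 0, …, v 9` is a presentation of a 10-cycle (indices modulo 10). -/
def IsTenCycle (m n : ℕ) (k ℓ : ZMod n) (v : Fin 10 → Vertex m n) : Prop :=
  Function.Injective v ∧ ∀ j, (graph m n k ℓ).Adj (v j) (v (j + 1))

open Classical in
/-- The sequence `c_0 c_1 ⋯ c_9` of a presentation: `0` for a link, `1` for a non-link. -/
noncomputable def tenCycleCode (m n : ℕ) (ℓ : ZMod n) (v : Fin 10 → Vertex m n) : Fin 10 → ℕ :=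
  fun j => if (linkGraph m n ℓ).Adj (v j) (v (j + 1)) then 0 else 1

/-- The graph has a 10-cycle of type 3, that is, one with code `1^3 0 1 0 1 0 1 0`. The code of a
cycle is taken up to rotations and reflections, so it is enough that one presentation of the cycle
has this sequence. -/
def HasTenCycleOfTypeThree (m n : ℕ) (k ℓ : ZMod n) : Prop :=
  ∃ v : Fin 10 → Vertex m n, IsTenCycle m n k ℓ v ∧
    tenCycleCode m n ℓ v = ![1, 1, 1, 0, 1, 0, 1, 0, 1, 0]

/-- The conditions on the parameters `m, n, k, ℓ`, with `n' = n / 2`. -/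
def Admissible (m n : ℕ) (k ℓ : ZMod n) : Prop :=
  4 ≤ m ∧ Even m ∧ 6 ≤ n ∧ Even n ∧ Even ℓ.val ∧ Odd k.val ∧
  (2 * k ≠ 2 ∧ 2 * k ≠ -2) ∧ (2 * k ^ 2 = 2 ∨ 2 * k ^ 2 = -2) ∧
  (((ℓ * k = ℓ ∨ ℓ * k = -ℓ) ∧ ((k ^ 2 = 1 ∨ k ^ 2 = -1) ∨ 4 ∣ m)) ∨
   ((ℓ * k = ((n / 2 : ℕ) : ZMod n) + ℓ ∨ ℓ * k = ((n / 2 : ℕ) : ZMod n) - ℓ) ∧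
     m ≡ 2 [MOD 4] ∧
     (k ^ 2 = ((n / 2 : ℕ) : ZMod n) + 1 ∨ k ^ 2 = ((n / 2 : ℕ) : ZMod n) - 1)))

/-- The basic changes of the pair `(k, ℓ)`, for fixed `m` and `n = 2n'`, that do not change the
isomorphism class of `X_a(m, n, k, ℓ)`. -/
inductive BasicMove (m n : ℕ) : ZMod n × ZMod n → ZMod n × ZMod n → Prop
  | neg_k (k ℓ : ZMod n) : BasicMove m n (k, ℓ) (-k, ℓ)
  | neg_l (k ℓ : ZMod n) : BasicMove m n (k, ℓ) (k, -ℓ)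
  | shift (k ℓ : ZMod n) (hn : 4 ∣ n) (hm : 4 ∣ m) :
      BasicMove m n (k, ℓ) (k + ((n / 2 : ℕ) : ZMod n), ℓ)
  | shift_both (k ℓ : ZMod n) (hn : 4 ∣ n) (hm : ¬ 4 ∣ m) :
      BasicMove m n (k, ℓ) (k + ((n / 2 : ℕ) : ZMod n), ℓ + ((n / 2 : ℕ) : ZMod n))

/-- `(k, ℓ)` and `(k', ℓ')` agree up to finitely many basic moves. -/
def MoveEquiv (m n : ℕ) (k ℓ k' ℓ' : ZMod n) : Prop :=
  Relation.EqvGen (BasicMove m n) (k, ℓ) (k', ℓ')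

end Xa

/-! Call a vertex up if its link leads to the next row. Every edge joins an up vertex to one that is
not up, and consecutive links of a 10-cycle of type 3 are separated by an odd number of non-links.
Hence all four links are crossed in the same direction, so `m = 4`, and adding the displacements
gives `ℓ = ±3 ± k ± 1 ± k` or `ℓ = ±3k ± 1 ± k ± 1` (`eq_four_of_hasTenCycleOfTypeThree`). From `4k
= ±4` and `2k ≠ ±2` it follows that `n = 8a` and, up to moves, `k = 2a + 1`
(`exists_stronglyEquiv`). Up to sign, seven values of `ℓ` remain; the condition `ℓk = ±ℓ` leaves
`4a`, `4 + 4a`, `4`, and `6` when `a = 3` (`eq_three_of_mul_eq`).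

It remains to prove that `𝒞` is invariant outside the two families. Colour the edges properly with
red, blue (non-links) and link. The number of closed non-backtracking walks of a given length with a
given beginning is preserved by automorphisms, and for short walks it is found by a finite check,
uniformly in `a`. For `ℓ = 4a` and for `ℓ = 6` such counts single out the links.

For `ℓ = 4` and `ℓ = 4 + 4a` they single out only the red edges, so an automorphism might exchange
blue edges and links at some vertices. Further counts make the pattern of exchanges periodic along
each row. Half a turn along a row ends where a short detour through an adjacent row ends
(`rowStep_iterate_eq`). If there is an exchange, the image of this identity compares a walk that
advances `2a` or `a` rows with one that advances 0 or 2 rows respectively (`exists_relation`). As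
there are four rows, `a` is even; for `ℓ = 4` only the first alternative occurs, and the
displacements along the row give `4 ∣ a`. What survives is exactly the two families, the case `a =
2`, `ℓ = 4` joining the first one through `ℓ ↦ -ℓ`. -/

namespace Xa

/-! ### The cover by `ℤ × ℤ` and the coloured edges -/

/-- The colours of the edges: `link` for the links, while the non-links of every cycle `C_i` are
coloured alternately `red` and `blue`. -/
inductive Color
  | red | blue | link
  deriving DecidableEq

/-- The projection from `ℤ × ℤ` onto the vertices; wrapping around the rows adds `ℓ`. -/
def proj (n : ℕ) (ℓ : ℤ) (y : ℤ × ℤ) : Vertex 4 n :=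
  ((y.1 : ZMod 4), ((y.2 + y.1 / 4 * ℓ : ℤ) : ZMod n))

/-- The step along the row `ρ`. -/
def stepSize (a : ℕ) (ρ : ℤ) : ℤ := if Even ρ then 1 else 2 * a + 1

/-- Traversing the edge of a given colour, in the cover `ℤ × ℤ`. -/
def move (a : ℕ) : Color → ℤ × ℤ → ℤ × ℤ
  | .red, y => (y.1, y.2 + if Even (y.1 + y.2) then -stepSize a y.1 else stepSize a y.1)
  | .blue, y => (y.1, y.2 + if Even (y.1 + y.2) then stepSize a y.1 else -stepSize a y.1)
  | .link, y => (y.1 + if Even (y.1 + y.2) then 1 else -1, y.2)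

/-- The graph `X_a(4, 8a, 2a + 1, ℓ)`. -/
abbrev specialGraph (a : ℕ) (ℓ : ℤ) : SimpleGraph (Vertex 4 (8 * a)) :=
  graph 4 (8 * a) ((2 * a + 1 : ℕ) : ZMod (8 * a)) (ℓ : ZMod (8 * a))

/-- The neighbour of a vertex along the edge of a given colour. -/
def nb (a : ℕ) (ℓ : ℤ) (c : Color) (v : Vertex 4 (8 * a)) : Vertex 4 (8 * a) :=
  proj (8 * a) ℓ (move a c ((v.1.val : ℤ), (v.2.val : ℤ)))

theorem odd_stepSize (a : ℕ) (ρ : ℤ) : Odd (stepSize a ρ) := by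
  unfold stepSize
  split_ifs
  · exact odd_one
  · exact ⟨a, rfl⟩

theorem stepSize_add (a : ℕ) (ρ w : ℤ) : stepSize a (ρ + 4 * w) = stepSize a ρ := by
  unfold stepSize
  have : Even (ρ + 4 * w) ↔ Even ρ := by grind
  simp [this]

theorem move_move (a : ℕ) (c : Color) (y : ℤ × ℤ) : move a c (move a c y) = y := by
  have hs := odd_stepSize a y.1
  obtain ⟨ρ, j⟩ := y
  simp only at hs
  cases c <;> simp only [move] <;> by_cases h : Even (ρ + j) <;> simp only [h, if_true, if_false]
  · have : ¬ Even (ρ + (j + -stepSize a ρ)) := by grind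
    simp [this]
  · have : Even (ρ + (j + stepSize a ρ)) := by grind
    simp [this]
  · have : ¬ Even (ρ + (j + stepSize a ρ)) := by grind
    simp [this]
  · have : Even (ρ + (j + -stepSize a ρ)) := by grind
    simp [this]
  · have : ¬ Even (ρ + 1 + j) := by grind
    simp [this]
  · have : Even (ρ + -1 + j) := by grind
    simp [this]

theorem proj_shift (n : ℕ) (ℓ ρ j w : ℤ) : proj n ℓ (ρ + 4 * w, j) = proj n ℓ (ρ, j + w * ℓ) := by
  unfold proj
  have h4 : ((4 : ℤ) : ZMod 4) = 0 := by decide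
  ext1
  · simp only; push_cast at h4 ⊢; rw [h4]; ring
  · simp only
    congr 1
    rw [Int.add_mul_ediv_left _ _ (by norm_num)]; ring

theorem proj_eq_iff (n : ℕ) (ℓ : ℤ) (y y' : ℤ × ℤ) :
    proj n ℓ y = proj n ℓ y' ↔ ∃ w, y.1 = y'.1 + 4 * w ∧ (n : ℤ) ∣ y.2 + w * ℓ - y'.2 := by
  obtain ⟨ρ, j⟩ := y
  obtain ⟨ρ', j'⟩ := y'
  simp only
  constructor
  · intro h
    have h1 : ((ρ : ℤ) : ZMod 4) = ((ρ' : ℤ) : ZMod 4) := congrArg Prod.fst h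
    obtain ⟨w, hw⟩ := (ZMod.intCast_eq_intCast_iff_dvd_sub ρ' ρ 4).1 h1.symm
    obtain rfl : ρ = ρ' + 4 * w := by push_cast at hw; linarith
    refine ⟨w, rfl, ?_⟩
    rw [proj_shift] at h
    have h2 := congrArg Prod.snd h
    simp only [proj] at h2
    have h3 := (ZMod.intCast_eq_intCast_iff_dvd_sub _ _ n).1 h2.symm
    convert h3 using 1; ring
  · rintro ⟨w, rfl, h⟩
    rw [proj_shift]
    unfold proj
    ext1
    · rfl
    · simp only
      symm
      rw [ZMod.intCast_eq_intCast_iff_dvd_sub]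
      convert h using 1; ring

theorem move_shift {a : ℕ} {ℓ : ℤ} (hℓ : Even ℓ) (c : Color) (ρ j w : ℤ) :
    proj (8 * a) ℓ (move a c (ρ + 4 * w, j)) = proj (8 * a) ℓ (move a c (ρ, j + w * ℓ)) := by
  have h1 : Even (ρ + 4 * w + j) ↔ Even (ρ + (j + w * ℓ)) := by
    have := hℓ.mul_left w
    grind
  cases c <;> simp only [move, stepSize_add, h1]
  · rw [proj_shift]; congr 2; ring
  · rw [proj_shift]; congr 2; ring
  · rw [← proj_shift]; congr 2; ring

/-- The fibres of `proj` are the orbits of the translations by `(4, -ℓ)` and `(0, 8a)`. Since `ℓ` is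
even, these preserve the parities of the row and of the coordinate sum, on which alone a move
depends; so moves descend to the graph. -/
theorem proj_move_congr {a : ℕ} {ℓ : ℤ} (hℓ : Even ℓ) (c : Color) {y y' : ℤ × ℤ}
    (h : proj (8 * a) ℓ y = proj (8 * a) ℓ y') :
    proj (8 * a) ℓ (move a c y) = proj (8 * a) ℓ (move a c y') := by
  obtain ⟨w, h1, t, h2⟩ := (proj_eq_iff _ _ _ _).1 h
  obtain ⟨ρ, j⟩ := y
  obtain ⟨ρ', j'⟩ := y'
  simp only at h1 h2
  subst h1
  rw [move_shift hℓ]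
  obtain rfl : j' = j + w * ℓ - (8 * a : ℕ) * t := by linarith
  generalize j + w * ℓ = i
  have hp : Even (ρ' + (i - (8 * a : ℕ) * t)) ↔ Even (ρ' + i) := by
    push_cast; grind
  rw [proj_eq_iff]
  cases c <;> simp only [move, hp]
  · exact ⟨0, by ring, t, by ring⟩
  · exact ⟨0, by ring, t, by ring⟩
  · exact ⟨0, by ring, t, by ring⟩

theorem proj_val (a : ℕ) [NeZero a] (ℓ : ℤ) (v : Vertex 4 (8 * a)) :
    proj (8 * a) ℓ ((v.1.val : ℤ), (v.2.val : ℤ)) = v := by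
  have : NeZero (8 * a) := ⟨by have := NeZero.ne a; omega⟩
  have h4 : ((v.1.val : ℤ)) / 4 = 0 := by
    have := ZMod.val_lt v.1
    omega
  unfold proj
  ext1
  · simp
  · simp only [h4]; simp

theorem exists_proj (a : ℕ) [NeZero a] (ℓ : ℤ) (v : Vertex 4 (8 * a)) :
    ∃ y, 0 ≤ y.1 ∧ y.1 < 4 ∧ proj (8 * a) ℓ y = v :=
  ⟨_, Int.natCast_nonneg _, by have := ZMod.val_lt v.1; simp only; omega, proj_val a ℓ v⟩

theorem nb_proj {a : ℕ} [NeZero a] {ℓ : ℤ} (hℓ : Even ℓ) (c : Color) (y : ℤ × ℤ) :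
    nb a ℓ c (proj (8 * a) ℓ y) = proj (8 * a) ℓ (move a c y) :=
  proj_move_congr hℓ c (proj_val a ℓ _)

theorem nb_nb {a : ℕ} [NeZero a] {ℓ : ℤ} (hℓ : Even ℓ) (c : Color) (v : Vertex 4 (8 * a)) :
    nb a ℓ c (nb a ℓ c v) = v := by
  obtain ⟨y, -, -, rfl⟩ := exists_proj a ℓ v
  rw [nb_proj hℓ, nb_proj hℓ, move_move]

theorem even_val_intCast {n : ℕ} [NeZero n] (hn : Even n) (j : ℤ) :
    Even ((j : ZMod n)).val ↔ Even j := by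
  have h : (((j : ZMod n).val : ℤ)) = j % n := ZMod.val_intCast j
  have h2 := Int.emod_add_mul_ediv j n
  rw [← h] at h2
  obtain ⟨t, ht⟩ := hn
  have hn2 : (n : ℤ) = t + t := by exact_mod_cast ht
  rw [hn2] at h2
  rw [← Int.even_coe_nat]
  generalize j / ((t : ℤ) + t) = q at h2
  generalize ((j : ZMod n).val : ℤ) = r at h2
  subst h2
  simp [← two_mul, mul_assoc, Int.even_add]

theorem parity_congr {a : ℕ} {ℓ : ℤ} (hℓ : Even ℓ) {y y' : ℤ × ℤ} (h : proj (8 * a) ℓ y = proj (8 * a) ℓ y') :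
    Even (y.1 + y.2) ↔ Even (y'.1 + y'.2) := by
  obtain ⟨w, h1, t, h2⟩ := (proj_eq_iff _ _ _ _).1 h
  obtain ⟨ρ, j⟩ := y
  obtain ⟨ρ', j'⟩ := y'
  simp only at h1 h2 ⊢
  have := hℓ.mul_left w
  push_cast at h2
  grind

theorem signature_proj {a : ℕ} {ℓ : ℤ} (y : ℤ × ℤ) :
    signature 4 (8 * a) ((2 * a + 1 : ℕ) : ZMod (8 * a)) (proj (8 * a) ℓ y).1 =
      (stepSize a y.1 : ZMod (8 * a)) := by
  unfold signature stepSize proj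
  simp only
  simp only [even_val_intCast (n := 4) (by decide)]
  split_ifs <;> push_cast <;> rfl

section

variable {a : ℕ} [NeZero a] {ℓ : ℤ}

theorem exists_proj_eq (y : ℤ × ℤ) :
    ∃ y', 0 ≤ y'.1 ∧ y'.1 < 4 ∧ proj (8 * a) ℓ y = proj (8 * a) ℓ y' := by
  obtain ⟨y', h1, h2, h3⟩ := exists_proj a ℓ (proj (8 * a) ℓ y)
  exact ⟨y', h1, h2, h3.symm⟩

theorem linkRel_proj (hℓ : Even ℓ) (y : ℤ × ℤ) (v : Vertex 4 (8 * a)) :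
    LinkRel 4 (8 * a) (ℓ : ZMod (8 * a)) (proj (8 * a) ℓ y) v ↔
      Even (y.1 + y.2) ∧ v = proj (8 * a) ℓ (move a .link y) := by
  have : NeZero (8 * a) := ⟨by have := NeZero.ne a; omega⟩
  obtain ⟨y', h0, h4, hy⟩ := exists_proj_eq (a := a) (ℓ := ℓ) y
  rw [parity_congr hℓ hy, proj_move_congr hℓ _ hy, hy]
  clear hy
  obtain ⟨ρ, j⟩ := y'
  simp only at h0 h4 ⊢
  have hj := even_val_intCast (n := 8 * a) (by simp [Nat.even_mul]; left; decide) (j + ρ / 4 * ℓ)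
  have hρ : ρ / 4 = 0 := by omega
  rw [hρ, zero_mul, add_zero] at hj
  have key : ((j : ZMod (8 * a)).val ≡ ((ρ : ZMod 4)).val [MOD 2]) ↔ Even (ρ + j) := by
    have hr := even_val_intCast (n := 4) (by decide) ρ
    rw [Nat.ModEq, Int.even_add, ← hj, ← hr, Nat.even_iff, Nat.even_iff]
    omega
  unfold LinkRel
  have e1 : (proj (8 * a) ℓ (ρ, j)).1 = (ρ : ZMod 4) := rfl
  have e2 : (proj (8 * a) ℓ (ρ, j)).2 = (j : ZMod (8 * a)) := by simp [proj, hρ]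
  rw [e1, e2, key]
  refine and_congr_right fun hup => ?_
  simp only [move, hup, if_true]
  interval_cases ρ
  · have : ((0 : ℤ) : ZMod 4).val = 0 := by decide
    simp only [this, proj]
    norm_num
  · have : ((1 : ℤ) : ZMod 4).val = 1 := by decide
    simp only [this, proj]
    norm_num
  · have : ((2 : ℤ) : ZMod 4).val = 2 := by decide
    simp only [this, proj]
    norm_num
  · have : ((3 : ℤ) : ZMod 4).val = 3 := by decide
    have h4 : ((4 : ℤ) : ZMod 4) = 0 := by decide
    simp only [this, proj]
    norm_num
    have h5 : (4 : ZMod 4) = 0 := by decide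
    rw [h5]

theorem linkGraph_adj (hℓ : Even ℓ) (y : ℤ × ℤ) (v : Vertex 4 (8 * a)) :
    (linkGraph 4 (8 * a) (ℓ : ZMod (8 * a))).Adj (proj (8 * a) ℓ y) v ↔
      v = proj (8 * a) ℓ (move a .link y) := by
  obtain ⟨y', -, -, rfl⟩ := exists_proj a ℓ v
  rw [linkGraph, SimpleGraph.fromRel_adj, linkRel_proj hℓ, linkRel_proj hℓ]
  constructor
  · rintro ⟨-, ⟨-, h⟩ | ⟨-, h⟩⟩
    · exact h
    · rw [proj_move_congr hℓ _ h, move_move]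
  · intro h
    refine ⟨?_, ?_⟩
    · rw [h]
      intro h'
      obtain ⟨w, hw, -⟩ := (proj_eq_iff _ _ _ _).1 h'
      simp only [move] at hw
      split_ifs at hw <;> omega
    · by_cases hup : Even (y.1 + y.2)
      · exact Or.inl ⟨hup, h⟩
      · refine Or.inr ⟨?_, ?_⟩
        · rw [parity_congr hℓ h]
          simp only [move, hup, if_false]
          grind
        · rw [proj_move_congr hℓ _ h, move_move]

theorem nonLinkGraph_adj (hℓ : Even ℓ) (y : ℤ × ℤ) (v : Vertex 4 (8 * a)) :
    (nonLinkGraph 4 (8 * a) ((2 * a + 1 : ℕ) : ZMod (8 * a))).Adj (proj (8 * a) ℓ y) v ↔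
      v = proj (8 * a) ℓ (move a .red y) ∨ v = proj (8 * a) ℓ (move a .blue y) := by
  have hrel (y : ℤ × ℤ) (v : Vertex 4 (8 * a)) :
      v = ((proj (8 * a) ℓ y).1, (proj (8 * a) ℓ y).2 +
        signature 4 (8 * a) ((2 * a + 1 : ℕ) : ZMod (8 * a)) (proj (8 * a) ℓ y).1) ↔
      v = proj (8 * a) ℓ (y.1, y.2 + stepSize a y.1) := by
    rw [signature_proj]
    unfold proj
    refine Eq.congr_right ?_
    ext1
    · rfl
    · simp only; push_cast; ring
  have hrb : (v = proj (8 * a) ℓ (move a .red y) ∨ v = proj (8 * a) ℓ (move a .blue y)) ↔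
      (v = proj (8 * a) ℓ (y.1, y.2 + stepSize a y.1) ∨
        v = proj (8 * a) ℓ (y.1, y.2 - stepSize a y.1)) := by
    simp only [move]
    split_ifs
    · rw [or_comm]; rfl
    · rfl
  rw [hrb]
  obtain ⟨y', -, -, rfl⟩ := exists_proj a ℓ v
  rw [nonLinkGraph, SimpleGraph.fromRel_adj, hrel, hrel]
  have aux : (proj (8 * a) ℓ y = proj (8 * a) ℓ (y'.1, y'.2 + stepSize a y'.1)) ↔
      (proj (8 * a) ℓ y' = proj (8 * a) ℓ (y.1, y.2 - stepSize a y.1)) := by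
    rw [proj_eq_iff, proj_eq_iff]
    constructor
    · rintro ⟨w, hw, t, ht⟩
      refine ⟨-w, ?_, -t, ?_⟩
      · simp only at hw ⊢; linarith
      · simp only at hw ht ⊢
        rw [hw, stepSize_add]; linarith
    · rintro ⟨w, hw, t, ht⟩
      refine ⟨-w, ?_, -t, ?_⟩
      · simp only at hw ⊢; linarith
      · simp only at hw ht ⊢
        rw [hw, stepSize_add]; linarith
  rw [aux]
  refine and_iff_right_of_imp fun h h' => ?_
  have hp := parity_congr hℓ h'
  have hs := odd_stepSize a y.1
  rcases h with h | h <;> have := parity_congr hℓ h <;> simp only at this <;> grind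

theorem graph_adj (hℓ : Even ℓ) (u v : Vertex 4 (8 * a)) :
    (specialGraph a ℓ).Adj u v ↔ ∃ c, v = nb a ℓ c u := by
  obtain ⟨y, -, -, rfl⟩ := exists_proj a ℓ u
  rw [specialGraph, graph, SimpleGraph.sup_adj, linkGraph_adj hℓ, nonLinkGraph_adj hℓ]
  simp only [← nb_proj hℓ]
  constructor
  · rintro (h | h | h)
    exacts [⟨_, h⟩, ⟨_, h⟩, ⟨_, h⟩]
  · rintro ⟨_ | _ | _, h⟩
    exacts [Or.inr (Or.inl h), Or.inr (Or.inr h), Or.inl h]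

theorem nb_injective (ha : 2 ≤ a) (hℓ : Even ℓ) (v : Vertex 4 (8 * a)) :
    Function.Injective fun c => nb a ℓ c v := by
  obtain ⟨y, -, -, rfl⟩ := exists_proj a ℓ v
  obtain ⟨ρ, j⟩ := y
  have hrb : proj (8 * a) ℓ (move a .red (ρ, j)) ≠ proj (8 * a) ℓ (move a .blue (ρ, j)) := by
    intro h
    obtain ⟨w, hw, t, ht⟩ := (proj_eq_iff _ _ _ _).1 h
    simp only [move] at hw ht
    obtain rfl : w = 0 := by linarith
    have : ∃ t : ℤ, 2 * stepSize a ρ = 8 * a * t := by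
      split_ifs at ht
      · exact ⟨-t, by push_cast at ht; linarith⟩
      · exact ⟨t, by push_cast at ht; linarith⟩
    obtain ⟨t, ht⟩ := this
    unfold stepSize at ht
    have ha' : (2 : ℤ) ≤ a := by exact_mod_cast ha
    split_ifs at ht
    · have h1 : (a : ℤ) * (4 * t) = 1 := by linarith
      have := Int.eq_one_or_neg_one_of_mul_eq_one h1
      omega
    · have h1 : (a : ℤ) * (4 * t - 2) = 1 := by linarith
      have := Int.eq_one_or_neg_one_of_mul_eq_one h1
      omega
  have hl (c : Color) (hc : c ≠ .link) :
      proj (8 * a) ℓ (move a c (ρ, j)) ≠ proj (8 * a) ℓ (move a .link (ρ, j)) := by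
    intro h
    obtain ⟨w, hw, -⟩ := (proj_eq_iff _ _ _ _).1 h
    cases c <;> simp only [move] at hw hc
    · split_ifs at hw <;> omega
    · split_ifs at hw <;> omega
    · exact hc rfl
  intro c c' h
  simp only [nb_proj hℓ] at h
  cases c <;> cases c' <;> first | rfl | skip
  · exact (hrb h).elim
  · exact (hl _ (by decide) h).elim
  · exact (hrb h.symm).elim
  · exact (hl _ (by decide) h).elim
  · exact (hl _ (by decide) h.symm).elim
  · exact (hl _ (by decide) h.symm).elim

/-! ### Action of automorphisms on colours and walk counts -/

/-- The colour of the image of the edge of colour `c` at `v`. -/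
noncomputable def colorMap (hℓ : Even ℓ) (φ : specialGraph a ℓ ≃g specialGraph a ℓ)
    (v : Vertex 4 (8 * a)) (c : Color) : Color :=
  Classical.choose ((graph_adj hℓ (φ v) (φ (nb a ℓ c v))).1
    (φ.map_adj_iff.2 ((graph_adj hℓ v _).2 ⟨c, rfl⟩)))

theorem map_nb (hℓ : Even ℓ) (φ : specialGraph a ℓ ≃g specialGraph a ℓ)
    (v : Vertex 4 (8 * a)) (c : Color) :
    φ (nb a ℓ c v) = nb a ℓ (colorMap hℓ φ v c) (φ v) :=
  Classical.choose_spec ((graph_adj hℓ (φ v) (φ (nb a ℓ c v))).1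
    (φ.map_adj_iff.2 ((graph_adj hℓ v _).2 ⟨c, rfl⟩)))

theorem colorMap_injective (ha : 2 ≤ a) (hℓ : Even ℓ)
    (φ : specialGraph a ℓ ≃g specialGraph a ℓ) (v : Vertex 4 (8 * a)) :
    Function.Injective (colorMap hℓ φ v) := by
  intro c c' h
  apply nb_injective ha hℓ v
  apply φ.injective
  simp only [map_nb hℓ, h]

theorem colorMap_nb (ha : 2 ≤ a) (hℓ : Even ℓ)
    (φ : specialGraph a ℓ ≃g specialGraph a ℓ) (v : Vertex 4 (8 * a)) (c : Color) :
    colorMap hℓ φ (nb a ℓ c v) c = colorMap hℓ φ v c := by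
  apply nb_injective ha hℓ (φ (nb a ℓ c v))
  simp only
  rw [← map_nb, nb_nb hℓ, map_nb hℓ, nb_nb hℓ]

/-- The number of walks of length `m` from `v` to `x` which do not backtrack, and which do not
start with the edge of colour `c`. -/
def walkCount (x : Vertex 4 (8 * a)) (ℓ : ℤ) : ℕ → Vertex 4 (8 * a) → Color → ℕ
  | 0, v, _ => if v = x then 1 else 0
  | m + 1, v, .red => walkCount x ℓ m (nb a ℓ .blue v) .blue + walkCount x ℓ m (nb a ℓ .link v) .link
  | m + 1, v, .blue => walkCount x ℓ m (nb a ℓ .red v) .red + walkCount x ℓ m (nb a ℓ .link v) .link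
  | m + 1, v, .link => walkCount x ℓ m (nb a ℓ .red v) .red + walkCount x ℓ m (nb a ℓ .blue v) .blue

/-- At each vertex an automorphism permutes the three colours, and an edge gets the same image
colour from both ends; so non-backtracking walks go to non-backtracking walks. -/
theorem walkCount_map (ha : 2 ≤ a) (hℓ : Even ℓ) (φ : specialGraph a ℓ ≃g specialGraph a ℓ)
    (x : Vertex 4 (8 * a)) (m : ℕ) (v : Vertex 4 (8 * a)) (c : Color) :
    walkCount (φ x) ℓ m (φ v) (colorMap hℓ φ v c) = walkCount x ℓ m v c := by
  induction m generalizing v c with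
  | zero => simp [walkCount]
  | succ m ih =>
    have key (c : Color) : walkCount (φ x) ℓ m (nb a ℓ (colorMap hℓ φ v c) (φ v))
        (colorMap hℓ φ v c) = walkCount x ℓ m (nb a ℓ c v) c := by
      rw [← ih, map_nb, colorMap_nb ha hℓ]
    have hinj := colorMap_injective ha hℓ φ v
    have h1 := hinj.ne (show Color.red ≠ .blue by decide)
    have h2 := hinj.ne (show Color.red ≠ .link by decide)
    have h3 := hinj.ne (show Color.blue ≠ .link by decide)
    have kr := key .red
    have kb := key .blue
    have kl := key .link
    cases hr : colorMap hℓ φ v .red <;> cases hb : colorMap hℓ φ v .blue <;>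
      cases hl : colorMap hℓ φ v .link <;> simp only [hr, hb, hl] at h1 h2 h3 kr kb kl <;>
      first
      | exact absurd rfl h1
      | exact absurd rfl h2
      | exact absurd rfl h3
      | (cases c <;> simp only [hr, hb, hl, walkCount, kr, kb, kl, add_comm])

end

/-! ### Walks in coordinates that do not involve `a` -/

/-- A vertex of the cover relative to a base vertex: `rows` counts the rows from it, the
displacement along the rows is `α + 2aβ`; `up` says whether the link at the vertex leads to the
next row, and `even` is the parity of the row. -/
structure RelPos where
  up : Bool
  even : Bool
  rows : ℤ
  α : ℤ
  β : ℤ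

/-- The counterpart of `move`. -/
def RelPos.move : Color → RelPos → RelPos
  | .red, ⟨true, true, r, α, β⟩ => ⟨false, true, r, α - 1, β⟩
  | .red, ⟨true, false, r, α, β⟩ => ⟨false, false, r, α - 1, β - 1⟩
  | .red, ⟨false, true, r, α, β⟩ => ⟨true, true, r, α + 1, β⟩
  | .red, ⟨false, false, r, α, β⟩ => ⟨true, false, r, α + 1, β + 1⟩
  | .blue, ⟨true, true, r, α, β⟩ => ⟨false, true, r, α + 1, β⟩
  | .blue, ⟨true, false, r, α, β⟩ => ⟨false, false, r, α + 1, β + 1⟩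
  | .blue, ⟨false, true, r, α, β⟩ => ⟨true, true, r, α - 1, β⟩
  | .blue, ⟨false, false, r, α, β⟩ => ⟨true, false, r, α - 1, β - 1⟩
  | .link, ⟨true, e, r, α, β⟩ => ⟨false, !e, r + 1, α, β⟩
  | .link, ⟨false, e, r, α, β⟩ => ⟨true, !e, r - 1, α, β⟩

/-- The vertex of the cover which has a given position relative to `y`. -/
def RelPos.eval (a : ℕ) (y : ℤ × ℤ) (σ : RelPos) : ℤ × ℤ :=
  (y.1 + σ.rows, y.2 + σ.α + 2 * a * σ.β)

/-- The two flags are the right ones. -/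
def RelPos.Fits (a : ℕ) (y : ℤ × ℤ) (σ : RelPos) : Prop :=
  (σ.up = true ↔ Even ((σ.eval a y).1 + (σ.eval a y).2)) ∧ (σ.even = true ↔ Even (σ.eval a y).1)

theorem RelPos.eval_move {a : ℕ} {y : ℤ × ℤ} {σ : RelPos} (h : σ.Fits a y) (c : Color) :
    (σ.move c).eval a y = Xa.move a c (σ.eval a y) := by
  obtain ⟨u, e, r, α, β⟩ := σ
  obtain ⟨h1, h2⟩ := h
  simp only [RelPos.eval] at h1 h2
  cases u <;> cases e <;> simp only [true_iff, false_iff, Bool.false_eq_true] at h1 h2 <;>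
    cases c <;> simp [RelPos.eval, RelPos.move, Xa.move, h1, h2, stepSize] <;> ring

theorem RelPos.Fits.move {a : ℕ} {y : ℤ × ℤ} {σ : RelPos} (h : σ.Fits a y) (c : Color) :
    (σ.move c).Fits a y := by
  obtain ⟨u, e, r, α, β⟩ := σ
  obtain ⟨ρ, j⟩ := y
  obtain ⟨h1, h2⟩ := h
  simp only [RelPos.eval] at h1 h2
  unfold RelPos.Fits
  cases u <;> cases e <;> simp only [true_iff, false_iff, Bool.false_eq_true] at h1 h2 <;>
    cases c <;> simp only [RelPos.eval, RelPos.move, true_iff, false_iff,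
      Bool.false_eq_true, Bool.not_true, Bool.not_false] <;>
    constructor <;> grind

/-- The counterpart of `walkCount`, for walks to vertices which pass a test. -/
def relCount (t : ℤ → ℤ → ℤ → Bool) : ℕ → RelPos → Color → ℕ
  | 0, σ, _ => if t σ.rows σ.α σ.β then 1 else 0
  | m + 1, σ, .red => relCount t m (σ.move .blue) .blue + relCount t m (σ.move .link) .link
  | m + 1, σ, .blue => relCount t m (σ.move .red) .red + relCount t m (σ.move .link) .link
  | m + 1, σ, .link => relCount t m (σ.move .red) .red + relCount t m (σ.move .blue) .blue

theorem relCount_mono {t t' : ℤ → ℤ → ℤ → Bool} (h : ∀ r α β, t r α β = true → t' r α β = true)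
    (m : ℕ) (σ : RelPos) (c : Color) : relCount t m σ c ≤ relCount t' m σ c := by
  induction m generalizing σ c with
  | zero =>
    simp only [relCount]
    split_ifs with h1 h2
    · rfl
    · exact absurd (h _ _ _ h1) h2
    · simp
    · rfl
  | succ m ih => cases c <;> exact Nat.add_le_add (ih _ _) (ih _ _)

/-- The test for the base vertex, where `ℓ = p + 2aq`. -/
def isBase (a : ℕ) (p q : ℤ) (r α β : ℤ) : Bool :=
  r % 4 = 0 ∧ (α + 2 * a * β + r / 4 * (p + 2 * a * q)) % (8 * a) = 0

/-- A condition which is sufficient for `isBase`. -/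
def isBaseGeneric (p q : ℤ) (r α β : ℤ) : Bool :=
  r % 4 = 0 ∧ α + r / 4 * p = 0 ∧ (β + r / 4 * q) % 4 = 0

/-- A condition which is necessary for `isBase` if `6 ≤ a`. -/
def mayBeBase (p q : ℤ) (r α β : ℤ) : Bool :=
  r % 4 = 0 ∧ (10 < (α + r / 4 * p).natAbs ∨ isBaseGeneric p q r α β)

theorem isBase_of_isBaseGeneric (a : ℕ) (p q r α β : ℤ) (h : isBaseGeneric p q r α β = true) :
    isBase a p q r α β = true := by
  simp only [isBaseGeneric, isBase, decide_eq_true_eq] at h ⊢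
  obtain ⟨h1, h2, h3⟩ := h
  refine ⟨h1, ?_⟩
  obtain ⟨d, hd⟩ := Int.dvd_of_emod_eq_zero h3
  exact Int.emod_eq_zero_of_dvd ⟨d, by linear_combination h2 + 2 * (a : ℤ) * hd⟩

theorem mayBeBase_of_isBase {a : ℕ} (ha : 6 ≤ a) (p q r α β : ℤ) (h : isBase a p q r α β = true) :
    mayBeBase p q r α β = true := by
  simp only [isBaseGeneric, isBase, mayBeBase, decide_eq_true_eq] at h ⊢
  obtain ⟨h1, h2⟩ := h
  refine ⟨h1, ?_⟩
  by_cases hb : 10 < (α + r / 4 * p).natAbs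
  · exact Or.inl hb
  refine Or.inr ⟨h1, ?_⟩
  obtain ⟨d, hd⟩ := Int.dvd_of_emod_eq_zero h2
  have key : α + r / 4 * p = 2 * a * (4 * d - (β + r / 4 * q)) := by linear_combination hd
  rw [key] at hb ⊢
  have ha' : (6 : ℤ) ≤ a := by exact_mod_cast ha
  -- The left side of `key` is a multiple of `2a ≥ 12` and has absolute value at most 10.
  have hz : 4 * d - (β + r / 4 * q) = 0 := by
    by_contra hne
    have h1 : 1 ≤ (4 * d - (β + r / 4 * q)).natAbs := Int.natAbs_pos.2 hne
    rw [Int.natAbs_mul, Int.natAbs_mul, Int.natAbs_natCast] at hb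
    have : 2 * a ≤ 2 * a * (4 * d - (β + r / 4 * q)).natAbs := Nat.le_mul_of_pos_right _ h1
    simp at hb
    omega
  rw [hz]
  exact ⟨by simp, by omega⟩

section

variable {a : ℕ} [NeZero a]

theorem walkCount_eq {ℓ p q : ℤ} (hℓ : Even ℓ) (hpq : ℓ = p + 2 * a * q) (y : ℤ × ℤ) (m : ℕ)
    (σ : RelPos) (h : σ.Fits a y) (c : Color) :
    walkCount (proj (8 * a) ℓ y) ℓ m (proj (8 * a) ℓ (σ.eval a y)) c =
      relCount (isBase a p q) m σ c := by
  induction m generalizing σ c with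
  | zero =>
    simp only [walkCount, relCount]
    congr 1
    rw [proj_eq_iff, isBase, decide_eq_true_eq]
    simp only [RelPos.eval, eq_iff_iff]
    constructor
    · rintro ⟨w, hw, hd⟩
      have hr : σ.rows = 4 * w := by linarith
      refine ⟨by omega, Int.emod_eq_zero_of_dvd ?_⟩
      rw [hr, Int.mul_ediv_cancel_left _ (by norm_num), ← hpq]
      convert hd using 1
      · push_cast; ring
      · ring
    · rintro ⟨h1, h2⟩
      have h2 := Int.dvd_of_emod_eq_zero h2
      refine ⟨σ.rows / 4, by omega, ?_⟩
      rw [hpq]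
      convert h2 using 1
      · push_cast; ring
      · ring
  | succ m ih =>
    have key (c : Color) : walkCount (proj (8 * a) ℓ y) ℓ m
        (nb a ℓ c (proj (8 * a) ℓ (σ.eval a y))) c = relCount (isBase a p q) m (σ.move c) c := by
      rw [nb_proj hℓ, ← RelPos.eval_move h, ih _ (h.move c)]
    cases c <;> simp only [walkCount, relCount, key]

theorem walkCount_foldl {ℓ p q : ℤ} (hℓ : Even ℓ) (hpq : ℓ = p + 2 * a * q) (y : ℤ × ℤ) (m : ℕ)
    (w : List Color) (σ : RelPos) (h : σ.Fits a y) (c : Color) :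
    walkCount (proj (8 * a) ℓ y) ℓ m
      (nb a ℓ c (w.foldl (fun v c => nb a ℓ c v) (proj (8 * a) ℓ (σ.eval a y)))) c =
      relCount (isBase a p q) m (RelPos.move c (w.foldl (fun σ c => RelPos.move c σ) σ)) c := by
  induction w generalizing σ with
  | nil =>
    rw [List.foldl_nil, List.foldl_nil, nb_proj hℓ, ← RelPos.eval_move h,
      walkCount_eq hℓ hpq y m _ (h.move c)]
  | cons d w ih =>
    rw [List.foldl_cons, List.foldl_cons, nb_proj hℓ, ← RelPos.eval_move h, ih _ (h.move d)]

/-- The number of closed walks of length `w.length + 1 + m` from `x` which do not backtrack and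
start with the colours `w, c`. -/
def closedCount (ℓ : ℤ) (m : ℕ) (x : Vertex 4 (8 * a)) (w : List Color) (c : Color) : ℕ :=
  walkCount x ℓ m (nb a ℓ c (w.foldl (fun v c => nb a ℓ c v) x)) c

/-- The counterpart of `closedCount`. -/
def relClosedCount (t : ℤ → ℤ → ℤ → Bool) (m : ℕ) (u e : Bool) (w : List Color) (c : Color) : ℕ :=
  relCount t m (RelPos.move c (w.foldl (fun σ c => RelPos.move c σ) ⟨u, e, 0, 0, 0⟩)) c

/-- A closed walk count sees its base vertex only through two bits, so four cases cover all
vertices. -/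
theorem closedCount_eq {ℓ p q : ℤ} (hℓ : Even ℓ) (hpq : ℓ = p + 2 * a * q)
    (x : Vertex 4 (8 * a)) :
    ∃ u e, ∀ m w c, closedCount ℓ m x w c = relClosedCount (isBase a p q) m u e w c := by
  obtain ⟨y, -, -, rfl⟩ := exists_proj a ℓ x
  refine ⟨decide (Even (y.1 + y.2)), decide (Even y.1), fun m w c => ?_⟩
  have h0 : (⟨decide (Even (y.1 + y.2)), decide (Even y.1), 0, 0, 0⟩ : RelPos).Fits a y := by
    simp [RelPos.Fits, RelPos.eval]
  have := walkCount_foldl hℓ hpq y m w _ h0 c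
  simpa [closedCount, relClosedCount, RelPos.eval] using this

/-- For `6 ≤ a`, generic counts suffice. -/
theorem relClosedCount_eq {a : ℕ} (ha : 6 ≤ a) {p q : ℤ} {m : ℕ} {u e : Bool} {w : List Color}
    {c : Color} {N : ℕ} (h1 : relClosedCount (isBaseGeneric p q) m u e w c = N)
    (h2 : relClosedCount (mayBeBase p q) m u e w c = N) :
    relClosedCount (isBase a p q) m u e w c = N :=
  -- The exact test lies between two tests that do not mention `a`; when their counts agree, so does
  -- the exact one.
  le_antisymm (h2 ▸ relCount_mono (mayBeBase_of_isBase ha p q) _ _ _)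
    (h1 ▸ relCount_mono (isBase_of_isBaseGeneric a p q) _ _ _)

/-- The image of a sequence of colours, as seen from `x`. -/
noncomputable def mapWord {ℓ : ℤ} (hℓ : Even ℓ) (φ : specialGraph a ℓ ≃g specialGraph a ℓ) :
    Vertex 4 (8 * a) → List Color → List Color
  | _, [] => []
  | x, c :: w => colorMap hℓ φ x c :: mapWord hℓ φ (nb a ℓ c x) w

theorem map_foldl {ℓ : ℤ} (hℓ : Even ℓ) (φ : specialGraph a ℓ ≃g specialGraph a ℓ)
    (x : Vertex 4 (8 * a)) (w : List Color) :
    φ (w.foldl (fun v c => nb a ℓ c v) x) =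
      (mapWord hℓ φ x w).foldl (fun v c => nb a ℓ c v) (φ x) := by
  induction w generalizing x with
  | nil => rfl
  | cons c w ih => rw [List.foldl_cons, ih, map_nb hℓ, mapWord, List.foldl_cons]

theorem closedCount_map {ℓ : ℤ} (ha : 2 ≤ a) (hℓ : Even ℓ)
    (φ : specialGraph a ℓ ≃g specialGraph a ℓ) (m : ℕ) (x : Vertex 4 (8 * a)) (w : List Color)
    (c : Color) :
    closedCount ℓ m (φ x) (mapWord hℓ φ x w)
      (colorMap hℓ φ (w.foldl (fun v c => nb a ℓ c v) x) c) = closedCount ℓ m x w c := by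
  unfold closedCount
  rw [← map_foldl, ← map_nb, ← colorMap_nb ha hℓ, walkCount_map ha hℓ]

end

/-! ### Invariance of `𝒞` in terms of rows and colours -/

theorem map_cycleAt {m n : ℕ} {k ℓ : ZMod n} (φ : graph m n k ℓ ≃g graph m n k ℓ)
    (h : ∀ x x' : Vertex m n, x.1 = x'.1 → (φ x).1 = (φ x').1)
    (h' : ∀ x x' : Vertex m n, x.1 = x'.1 → (φ.symm x).1 = (φ.symm x').1) (x : Vertex m n) :
    SimpleGraph.Subgraph.map φ.toHom (cycleAt m n k ℓ x.1) = cycleAt m n k ℓ (φ x).1 := by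
  have hmem (v : Vertex m n) : v.1 = x.1 ↔ (φ v).1 = (φ x).1 :=
    ⟨h v x, fun hv => by simpa using h' _ _ hv⟩
  ext u v
  · constructor
    · rintro ⟨w, hw, rfl⟩
      exact (hmem w).1 hw
    · intro hu
      refine ⟨φ.symm u, (hmem _).2 ?_, φ.apply_symm_apply u⟩
      rw [φ.apply_symm_apply]; exact hu
  · constructor
    · rintro ⟨s, t, ⟨hs, ht, hst⟩, rfl, rfl⟩
      exact ⟨(hmem s).1 hs, (hmem t).1 ht, φ.map_adj_iff.2 hst⟩
    · rintro ⟨hu, hv, huv⟩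
      refine ⟨φ.symm u, φ.symm v, ⟨(hmem _).2 ?_, (hmem _).2 ?_, φ.symm.map_adj_iff.2 huv⟩,
        φ.apply_symm_apply u, φ.apply_symm_apply v⟩
      · rw [φ.apply_symm_apply]; exact hu
      · rw [φ.apply_symm_apply]; exact hv

theorem twoFactorAutInvariant_iff {m n : ℕ} {k ℓ : ZMod n} :
    TwoFactorAutInvariant m n k ℓ ↔ ∀ φ : graph m n k ℓ ≃g graph m n k ℓ,
      ∀ x x' : Vertex m n, x.1 = x'.1 → (φ x).1 = (φ x').1 := by
  constructor
  · intro h φ x x' hx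
    have h1 : SimpleGraph.Subgraph.map φ.toHom (cycleAt m n k ℓ x.1) ∈ twoFactor m n k ℓ := by
      rw [← h φ]
      exact ⟨_, ⟨_, rfl⟩, rfl⟩
    obtain ⟨i, hi⟩ := h1
    have key (y : Vertex m n) (hy : y.1 = x.1) : (φ y).1 = i := by
      have h2 : φ y ∈ (SimpleGraph.Subgraph.map φ.toHom (cycleAt m n k ℓ x.1)).verts :=
        ⟨y, hy, rfl⟩
      rw [← hi] at h2
      exact h2
    rw [key x rfl, key x' hx.symm]
  · intro h φ
    ext C
    constructor
    · rintro ⟨_, ⟨i, rfl⟩, rfl⟩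
      exact ⟨_, (map_cycleAt φ (h φ) (h φ.symm) (i, 0)).symm⟩
    · rintro ⟨i, rfl⟩
      refine ⟨_, ⟨(φ.symm (i, 0)).1, rfl⟩, ?_⟩
      simp only
      rw [map_cycleAt φ (h φ) (h φ.symm), φ.apply_symm_apply]

section

variable {a : ℕ} [NeZero a] {ℓ : ℤ}

/-- The step size is coprime to `8a`, so the non-links connect each row. -/
theorem eq_of_row_eq {β : Type*} (hℓ : Even ℓ) (f : Vertex 4 (8 * a) → β)
    (hr : ∀ x, f (nb a ℓ .red x) = f x) (hb : ∀ x, f (nb a ℓ .blue x) = f x)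
    (x x' : Vertex 4 (8 * a)) (h : x.1 = x'.1) : f x = f x' := by
  obtain ⟨⟨ρ, j⟩, -, -, rfl⟩ := exists_proj a ℓ x
  obtain ⟨⟨ρ', j'⟩, -, -, rfl⟩ := exists_proj a ℓ x'
  obtain ⟨w, hw⟩ := (ZMod.intCast_eq_intCast_iff_dvd_sub _ _ 4).1 h.symm
  obtain rfl : ρ = ρ' + 4 * w := by push_cast at hw; linarith
  rw [proj_shift]
  generalize j + w * ℓ = i
  have step (i : ℤ) : f (proj (8 * a) ℓ (ρ', i + stepSize a ρ')) = f (proj (8 * a) ℓ (ρ', i)) := by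
    by_cases hup : Even (ρ' + i)
    · rw [← hb (proj (8 * a) ℓ (ρ', i)), nb_proj hℓ]
      simp [move, hup]
    · rw [← hr (proj (8 * a) ℓ (ρ', i)), nb_proj hℓ]
      simp [move, hup]
  have steps (t : ℕ) (i : ℤ) :
      f (proj (8 * a) ℓ (ρ', i + t * stepSize a ρ')) = f (proj (8 * a) ℓ (ρ', i)) := by
    induction t with
    | zero => simp
    | succ t ih => rw [← ih, ← step (i + t * stepSize a ρ')]; congr 3; push_cast; ring
  obtain ⟨u, v, huv⟩ : ∃ u v : ℤ, u * stepSize a ρ' + v * (8 * a) = 1 := by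
    unfold stepSize
    split_ifs
    · exact ⟨1, 0, by ring⟩
    -- Bézout coefficients from `(1 + 2a)(1 - 2a + 4a²) = 1 + 8a³`.
    · exact ⟨1 - 2 * a + 4 * a ^ 2, -a ^ 2, by ring⟩
  have ha : (0 : ℤ) < 8 * a := by have := NeZero.pos a; omega
  have ht := Int.emod_nonneg (u * (j' - i)) ha.ne'
  rw [← steps ((u * (j' - i)) % (8 * a)).toNat i, Int.toNat_of_nonneg ht]
  congr 1
  rw [proj_eq_iff]
  refine ⟨0, by ring, -(u * (j' - i) / (8 * a) * stepSize a ρ' + v * (j' - i)), ?_⟩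
  have := Int.emod_add_mul_ediv (u * (j' - i)) (8 * a)
  push_cast
  linear_combination (stepSize a ρ') * this + (j' - i) * huv

theorem nb_row (hℓ : Even ℓ) {c : Color} (hc : c ≠ .link) (x : Vertex 4 (8 * a)) :
    (nb a ℓ c x).1 = x.1 := by
  obtain ⟨y, -, -, rfl⟩ := exists_proj a ℓ x
  rw [nb_proj hℓ]
  cases c
  · rfl
  · rfl
  · exact absurd rfl hc

theorem twoFactorAutInvariant_of_colorMap (ha : 2 ≤ a) (hℓ : Even ℓ)
    (h : ∀ φ : specialGraph a ℓ ≃g specialGraph a ℓ, ∀ x, colorMap hℓ φ x .link = .link) :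
    TwoFactorAutInvariant 4 (8 * a) ((2 * a + 1 : ℕ) : ZMod (8 * a)) (ℓ : ZMod (8 * a)) := by
  rw [twoFactorAutInvariant_iff]
  intro φ
  have key (c : Color) (hc : c ≠ .link) (x : Vertex 4 (8 * a)) :
      (φ (nb a ℓ c x)).1 = (φ x).1 := by
    rw [map_nb hℓ, nb_row hℓ]
    rw [← h φ x]
    exact (colorMap_injective ha hℓ φ x).ne hc
  exact eq_of_row_eq hℓ (fun x => (φ x).1) (key .red (by decide)) (key .blue (by decide))

/-- Links are recognised by the number of short cycles through them. -/
theorem twoFactorAutInvariant_of_closedCount (ha : 2 ≤ a) (hℓ : Even ℓ) (m N : ℕ)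
    (h : ∀ x : Vertex 4 (8 * a), ∀ c, closedCount ℓ m x [] c = N ↔ c = .link) :
    TwoFactorAutInvariant 4 (8 * a) ((2 * a + 1 : ℕ) : ZMod (8 * a)) (ℓ : ZMod (8 * a)) := by
  refine twoFactorAutInvariant_of_colorMap ha hℓ fun φ x => ?_
  have h1 := closedCount_map ha hℓ φ m x [] .link
  rw [(h x .link).2 rfl] at h1
  exact (h _ _).1 h1

/-- If the count recognises the paths of two edges without red, then the pair blue, link at `x` goes
to a pair without red, which leaves red for the third edge. The path is started at the blue
neighbour so that `x` is its middle vertex. -/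
theorem colorMap_red (ha : 2 ≤ a) (hℓ : Even ℓ) (m N : ℕ)
    (h : ∀ x : Vertex 4 (8 * a), ∀ c c', c ≠ c' →
      (closedCount ℓ m x [c] c' = N ↔ c ≠ .red ∧ c' ≠ .red))
    (φ : specialGraph a ℓ ≃g specialGraph a ℓ) (x : Vertex 4 (8 * a)) :
    colorMap hℓ φ x .red = .red := by
  have h1 := closedCount_map ha hℓ φ m (nb a ℓ .blue x) [.blue] .link
  rw [(h _ .blue .link (by decide)).2 (by decide)] at h1
  simp only [mapWord, List.foldl_cons, List.foldl_nil, nb_nb hℓ, colorMap_nb ha hℓ] at h1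
  have hinj := colorMap_injective ha hℓ φ x
  obtain ⟨hb, hl⟩ := (h _ _ _ (hinj.ne (by decide))).1 h1
  have h2 := hinj.ne (show Color.red ≠ .blue by decide)
  have h3 := hinj.ne (show Color.red ≠ .link by decide)
  have h4 := hinj.ne (show Color.blue ≠ .link by decide)
  revert hb hl h2 h3 h4
  generalize colorMap hℓ φ x .red = r
  generalize colorMap hℓ φ x .blue = b
  generalize colorMap hℓ φ x .link = l
  cases r <;> cases b <;> cases l <;> simp

/-! ### Half turns along a row and the relations they force -/

/-- Two steps along a row. -/
def rowStep (a : ℕ) (ℓ : ℤ) (x : Vertex 4 (8 * a)) : Vertex 4 (8 * a) :=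
  nb a ℓ .red (nb a ℓ .blue x)

theorem nb_red_up (hℓ : Even ℓ) {ρ j : ℤ} (h : Even (ρ + j)) :
    nb a ℓ .red (proj (8 * a) ℓ (ρ, j)) = proj (8 * a) ℓ (ρ, j - stepSize a ρ) := by
  rw [nb_proj hℓ]; simp [move, h, sub_eq_add_neg]

theorem nb_red_down (hℓ : Even ℓ) {ρ j : ℤ} (h : ¬ Even (ρ + j)) :
    nb a ℓ .red (proj (8 * a) ℓ (ρ, j)) = proj (8 * a) ℓ (ρ, j + stepSize a ρ) := by
  rw [nb_proj hℓ]; simp [move, h]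

theorem nb_blue_up (hℓ : Even ℓ) {ρ j : ℤ} (h : Even (ρ + j)) :
    nb a ℓ .blue (proj (8 * a) ℓ (ρ, j)) = proj (8 * a) ℓ (ρ, j + stepSize a ρ) := by
  rw [nb_proj hℓ]; simp [move, h]

theorem nb_blue_down (hℓ : Even ℓ) {ρ j : ℤ} (h : ¬ Even (ρ + j)) :
    nb a ℓ .blue (proj (8 * a) ℓ (ρ, j)) = proj (8 * a) ℓ (ρ, j - stepSize a ρ) := by
  rw [nb_proj hℓ]; simp [move, h, sub_eq_add_neg]

theorem nb_link_up (hℓ : Even ℓ) {ρ j : ℤ} (h : Even (ρ + j)) :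
    nb a ℓ .link (proj (8 * a) ℓ (ρ, j)) = proj (8 * a) ℓ (ρ + 1, j) := by
  rw [nb_proj hℓ]; simp [move, h]

theorem nb_link_down (hℓ : Even ℓ) {ρ j : ℤ} (h : ¬ Even (ρ + j)) :
    nb a ℓ .link (proj (8 * a) ℓ (ρ, j)) = proj (8 * a) ℓ (ρ - 1, j) := by
  rw [nb_proj hℓ]; simp [move, h, sub_eq_add_neg]

end

section

variable {a : ℕ} [NeZero a] {ℓ : ℤ}

theorem rowStep_up (hℓ : Even ℓ) {ρ j : ℤ} (h : Even (ρ + j)) :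
    rowStep a ℓ (proj (8 * a) ℓ (ρ, j)) = proj (8 * a) ℓ (ρ, j + 2 * stepSize a ρ) := by
  have hs := odd_stepSize a ρ
  rw [rowStep, nb_blue_up hℓ h, nb_red_down hℓ (by grind)]
  congr 2; ring

theorem rowStep_down (hℓ : Even ℓ) {ρ j : ℤ} (h : ¬ Even (ρ + j)) :
    rowStep a ℓ (proj (8 * a) ℓ (ρ, j)) = proj (8 * a) ℓ (ρ, j - 2 * stepSize a ρ) := by
  have hs := odd_stepSize a ρ
  rw [rowStep, nb_blue_down hℓ h, nb_red_up hℓ (by grind)]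
  congr 2; ring

theorem rowStep_iterate_up (hℓ : Even ℓ) {ρ j : ℤ} (h : Even (ρ + j)) (i : ℕ) :
    (fun x => rowStep a ℓ (rowStep a ℓ x))^[i] (proj (8 * a) ℓ (ρ, j)) =
      proj (8 * a) ℓ (ρ, j + 4 * i * stepSize a ρ) := by
  induction i with
  | zero => simp
  | succ i ih =>
    rw [Function.iterate_succ_apply', ih, rowStep_up hℓ (by grind), rowStep_up hℓ (by grind)]
    congr 2; push_cast; ring

theorem rowStep_iterate_down (hℓ : Even ℓ) {ρ j : ℤ} (h : ¬ Even (ρ + j)) (i : ℕ) :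
    (fun x => rowStep a ℓ (rowStep a ℓ x))^[i] (proj (8 * a) ℓ (ρ, j)) =
      proj (8 * a) ℓ (ρ, j - 4 * i * stepSize a ρ) := by
  induction i with
  | zero => simp
  | succ i ih =>
    rw [Function.iterate_succ_apply', ih, rowStep_down hℓ (by grind), rowStep_down hℓ (by grind)]
    congr 2; push_cast; ring

theorem stepSize_succ (a : ℕ) (ρ : ℤ) :
    stepSize a ρ = 1 ∧ stepSize a (ρ + 1) = 2 * a + 1 ∨
      stepSize a ρ = 2 * a + 1 ∧ stepSize a (ρ + 1) = 1 := by
  unfold stepSize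
  by_cases h : Even ρ
  · left
    have : ¬ Even (ρ + 1) := by grind
    simp [h, this]
  · right
    have : Even (ρ + 1) := by grind
    simp [h, this]

theorem stepSize_pred (a : ℕ) (ρ : ℤ) :
    stepSize a ρ = 1 ∧ stepSize a (ρ - 1) = 2 * a + 1 ∨
      stepSize a ρ = 2 * a + 1 ∧ stepSize a (ρ - 1) = 1 := by
  have := stepSize_succ a (ρ - 1)
  rw [sub_add_cancel] at this
  tauto

/-- Half of a turn along a row, and a shortcut. -/
theorem rowStep_iterate_eq (hℓ : Even ℓ) (x : Vertex 4 (8 * a)) :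
    (fun x => rowStep a ℓ (rowStep a ℓ x))^[a] x =
      nb a ℓ .link (rowStep a ℓ (nb a ℓ .link (rowStep a ℓ x))) := by
  obtain ⟨⟨ρ, j⟩, -, -, rfl⟩ := exists_proj a ℓ x
  by_cases h : Even (ρ + j)
  · rw [rowStep_iterate_up hℓ h, rowStep_up hℓ h, nb_link_up hℓ (by grind),
      rowStep_down hℓ (by grind), nb_link_down hℓ (by grind), proj_eq_iff]
    rcases stepSize_succ a ρ with ⟨h1, h2⟩ | ⟨h1, h2⟩ <;> simp only [h1, h2]
    · exact ⟨0, by ring, 1, by push_cast; ring⟩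
    · exact ⟨0, by ring, a, by push_cast; ring⟩
  · rw [rowStep_iterate_down hℓ h, rowStep_down hℓ h, nb_link_down hℓ (by grind),
      rowStep_up hℓ (by grind), nb_link_up hℓ (by grind), proj_eq_iff]
    rcases stepSize_pred a ρ with ⟨h1, h2⟩ | ⟨h1, h2⟩ <;> simp only [h1, h2]
    · exact ⟨0, by ring, -1, by push_cast; ring⟩
    · exact ⟨0, by ring, -a, by push_cast; ring⟩

/-- If the red edges are preserved and the pattern of exchanges of blue edges and links has
period two along the rows, then an automorphism which exchanges them somewhere gives rise to
a relation. -/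
theorem exists_relation (ha : 2 ≤ a) (hℓ : Even ℓ) (φ : specialGraph a ℓ ≃g specialGraph a ℓ)
    (hred : ∀ x, colorMap hℓ φ x .red = .red)
    (hper : ∀ x, colorMap hℓ φ (rowStep a ℓ (rowStep a ℓ x)) .blue = colorMap hℓ φ x .blue)
    (x : Vertex 4 (8 * a)) (hx : colorMap hℓ φ x .link ≠ .link) :
    (colorMap hℓ φ (rowStep a ℓ x) .blue = .link ∧
      (fun y => nb a ℓ .red (nb a ℓ .link (nb a ℓ .red (nb a ℓ .link y))))^[a] (φ x) =
        nb a ℓ .blue (nb a ℓ .red (nb a ℓ .link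
          (nb a ℓ .blue (nb a ℓ .red (nb a ℓ .link (φ x))))))) ∨
    (colorMap hℓ φ (rowStep a ℓ x) .blue = .blue ∧
      (fun y => nb a ℓ .red (nb a ℓ .blue (nb a ℓ .red (nb a ℓ .link y))))^[a] (φ x) =
        nb a ℓ .blue (nb a ℓ .red (nb a ℓ .blue
          (nb a ℓ .link (nb a ℓ .red (nb a ℓ .link (φ x))))))) := by
  have hcases (v) : colorMap hℓ φ v .blue = .link ∧ colorMap hℓ φ v .link = .blue ∨
      colorMap hℓ φ v .blue = .blue ∧ colorMap hℓ φ v .link = .link := by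
    have hinj := colorMap_injective ha hℓ φ v
    have h2 := hinj.ne (show Color.red ≠ .blue by decide)
    have h3 := hinj.ne (show Color.red ≠ .link by decide)
    have h4 := hinj.ne (show Color.blue ≠ .link by decide)
    rw [hred] at h2 h3
    revert h2 h3 h4
    generalize colorMap hℓ φ v .blue = b
    generalize colorMap hℓ φ v .link = l
    cases b <;> cases l <;> simp
  have hx1 : colorMap hℓ φ x .blue = .link ∧ colorMap hℓ φ x .link = .blue := by
    rcases hcases x with h | h
    · exact h
    · exact absurd h.2 hx
  have hstep (v) : φ (rowStep a ℓ v) = nb a ℓ .red (nb a ℓ (colorMap hℓ φ v .blue) (φ v)) := by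
    rw [rowStep, map_nb hℓ, hred, map_nb hℓ]
  -- Periodicity makes the image of every double row step the same word, whose second free colour is
  -- the image of blue at `rowStep a ℓ x`.
  have hiter (i : ℕ) :
      colorMap hℓ φ ((fun x => rowStep a ℓ (rowStep a ℓ x))^[i] x) .blue = .link ∧
      colorMap hℓ φ (rowStep a ℓ ((fun x => rowStep a ℓ (rowStep a ℓ x))^[i] x)) .blue =
        colorMap hℓ φ (rowStep a ℓ x) .blue ∧
      φ ((fun x => rowStep a ℓ (rowStep a ℓ x))^[i] x) =
        (fun y => nb a ℓ .red (nb a ℓ (colorMap hℓ φ (rowStep a ℓ x) .blue)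
          (nb a ℓ .red (nb a ℓ .link y))))^[i] (φ x) := by
    induction i with
    | zero => exact ⟨hx1.1, rfl, rfl⟩
    | succ i ih =>
      obtain ⟨h1, h2, h3⟩ := ih
      rw [Function.iterate_succ_apply', Function.iterate_succ_apply']
      refine ⟨by rw [hper, h1], by rw [hper, h2], ?_⟩
      rw [hstep, hstep, h1, h2, h3]
  obtain ⟨h1, -, h3⟩ := hiter a
  rw [rowStep_iterate_eq hℓ] at h1 h3
  -- The detour ends at an iterate of the double step, where by periodicity blue and link are again
  -- exchanged; its last edge is a link, so the image of that edge is blue.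
  have hlast : colorMap hℓ φ (rowStep a ℓ (nb a ℓ .link (rowStep a ℓ x))) .link = .blue := by
    rw [← colorMap_nb ha hℓ]
    rcases hcases (nb a ℓ .link (rowStep a ℓ (nb a ℓ .link (rowStep a ℓ x)))) with h | h
    · exact h.2
    · rw [h.1] at h1; exact absurd h1 (by decide)
  -- The middle link of the detour has one image colour from both ends, so its two ends are either
  -- both exchanged or both not.
  have hmid := colorMap_nb ha hℓ φ (rowStep a ℓ x) .link
  rw [map_nb hℓ, hlast, hstep, map_nb hℓ, hstep, hx1.1] at h3
  rcases hcases (rowStep a ℓ x) with h | h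
  · refine Or.inl ⟨h.1, ?_⟩
    rw [h.1, h.2] at h3
    rw [h.2] at hmid
    rcases hcases (nb a ℓ .link (rowStep a ℓ x)) with h' | h'
    · rw [h'.1] at h3
      exact h3.symm
    · rw [h'.2] at hmid; exact absurd hmid (by decide)
  · refine Or.inr ⟨h.1, ?_⟩
    rw [h.1, h.2] at h3
    rw [h.2] at hmid
    rcases hcases (nb a ℓ .link (rowStep a ℓ x)) with h' | h'
    · rw [h'.2] at hmid; exact absurd hmid (by decide)
    · rw [h'.1] at h3
      exact h3.symm

/-- Two consecutive rows contribute one step of size `1` and one of size `2a + 1`, whence `2a + 2`.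
-/
theorem link_red_iterate_up (hℓ : Even ℓ) {ρ j : ℤ} (h : Even (ρ + j)) (i : ℕ) :
    (fun y => nb a ℓ .red (nb a ℓ .link (nb a ℓ .red (nb a ℓ .link y))))^[i]
        (proj (8 * a) ℓ (ρ, j)) = proj (8 * a) ℓ (ρ + 2 * i, j + i * (2 * a + 2)) := by
  induction i with
  | zero => simp
  | succ i ih =>
    have hs (r) := odd_stepSize a r
    rw [Function.iterate_succ_apply', ih, nb_link_up hℓ (by grind), nb_red_down hℓ (by grind),
      nb_link_up hℓ (by grind), nb_red_down hℓ (by grind), proj_eq_iff]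
    refine ⟨0, by push_cast; ring, 0, ?_⟩
    rcases stepSize_succ a (ρ + 2 * i + 1) with ⟨h1, h2⟩ | ⟨h1, h2⟩ <;> simp only [h1, h2] <;>
      push_cast <;> ring

theorem link_red_iterate_down (hℓ : Even ℓ) {ρ j : ℤ} (h : ¬ Even (ρ + j)) (i : ℕ) :
    (fun y => nb a ℓ .red (nb a ℓ .link (nb a ℓ .red (nb a ℓ .link y))))^[i]
        (proj (8 * a) ℓ (ρ, j)) = proj (8 * a) ℓ (ρ - 2 * i, j - i * (2 * a + 2)) := by
  induction i with
  | zero => simp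
  | succ i ih =>
    have hs (r) := odd_stepSize a r
    rw [Function.iterate_succ_apply', ih, nb_link_down hℓ (by grind), nb_red_up hℓ (by grind),
      nb_link_down hℓ (by grind), nb_red_up hℓ (by grind), proj_eq_iff]
    refine ⟨0, by push_cast; ring, 0, ?_⟩
    rcases stepSize_pred a (ρ - 2 * i - 1) with ⟨h1, h2⟩ | ⟨h1, h2⟩ <;> simp only [h1, h2] <;>
      push_cast <;> ring

theorem link_red_blue_red_iterate_up (hℓ : Even ℓ) {ρ j : ℤ} (h : Even (ρ + j)) (i : ℕ) :
    ∃ j', Even (ρ + i + j') ∧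
      (fun y => nb a ℓ .red (nb a ℓ .blue (nb a ℓ .red (nb a ℓ .link y))))^[i]
        (proj (8 * a) ℓ (ρ, j)) = proj (8 * a) ℓ (ρ + i, j') := by
  induction i with
  | zero => exact ⟨j, by simpa using h, by simp⟩
  | succ i ih =>
    obtain ⟨j', h1, h2⟩ := ih
    have hs := odd_stepSize a (ρ + i + 1)
    refine ⟨j' + stepSize a (ρ + i + 1) + stepSize a (ρ + i + 1) + stepSize a (ρ + i + 1),
      by push_cast; grind, ?_⟩
    rw [Function.iterate_succ_apply', h2, nb_link_up hℓ h1, nb_red_down hℓ (by grind),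
      nb_blue_up hℓ (by grind), nb_red_down hℓ (by grind)]
    congr 2; push_cast; ring

theorem link_red_blue_red_iterate_down (hℓ : Even ℓ) {ρ j : ℤ} (h : ¬ Even (ρ + j)) (i : ℕ) :
    ∃ j', ¬ Even (ρ - i + j') ∧
      (fun y => nb a ℓ .red (nb a ℓ .blue (nb a ℓ .red (nb a ℓ .link y))))^[i]
        (proj (8 * a) ℓ (ρ, j)) = proj (8 * a) ℓ (ρ - i, j') := by
  induction i with
  | zero => exact ⟨j, by simpa using h, by simp⟩
  | succ i ih =>
    obtain ⟨j', h1, h2⟩ := ih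
    have hs := odd_stepSize a (ρ - i - 1)
    refine ⟨j' - stepSize a (ρ - i - 1) - stepSize a (ρ - i - 1) - stepSize a (ρ - i - 1),
      by push_cast; grind, ?_⟩
    rw [Function.iterate_succ_apply', h2, nb_link_down hℓ h1, nb_red_up hℓ (by grind),
      nb_blue_down hℓ (by grind), nb_red_up hℓ (by grind)]
    congr 2; push_cast; ring

/-- The left walk moves `2a` rows and the right one returns to its row, so `4 ∣ 2a`. Going around `a
/ 2` times adds `2a` to the displacement when `ℓ = 4`; with `a(2a + 2)` on the left and `±4a` on the
right, this leaves `8a ∣ 2a²`. -/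
theorem even_of_relation_link (hℓ : Even ℓ) (x : Vertex 4 (8 * a))
    (h : (fun y => nb a ℓ .red (nb a ℓ .link (nb a ℓ .red (nb a ℓ .link y))))^[a] x =
      nb a ℓ .blue (nb a ℓ .red (nb a ℓ .link (nb a ℓ .blue (nb a ℓ .red (nb a ℓ .link x)))))) :
    Even a ∧ (ℓ = 4 → 4 ∣ a) := by
  have ha0 : (a : ℤ) ≠ 0 := by exact_mod_cast NeZero.ne a
  obtain ⟨⟨ρ, j⟩, -, -, rfl⟩ := exists_proj a ℓ x
  have hs (r) := odd_stepSize a r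
  have key (t : ℤ) (w : ℤ) (h1 : (a : ℤ) = 2 * w) (h2 : 2 * (a : ℤ) ^ 2 = 8 * a * t) : 4 ∣ a := by
    have h3 : (a : ℤ) * (a - 4 * t) = 0 := by linarith
    have h4 := (mul_eq_zero.1 h3).resolve_left ha0
    omega
  by_cases hup : Even (ρ + j)
  · rw [link_red_iterate_up hℓ hup, nb_link_up hℓ hup, nb_red_down hℓ (by grind),
      nb_blue_up hℓ (by grind), nb_link_down hℓ (by grind), nb_red_up hℓ (by grind),
      nb_blue_down hℓ (by grind), proj_eq_iff] at h
    obtain ⟨w, h1, t, h2⟩ := h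
    simp only [add_sub_cancel_right] at h1 h2
    have haw : (a : ℤ) = 2 * w := by linarith
    refine ⟨by grind, fun h4 => ?_⟩
    subst h4
    push_cast at h2
    rcases stepSize_succ a ρ with ⟨e1, e2⟩ | ⟨e1, e2⟩ <;> rw [e1, e2] at h2
    · exact key t w haw (by linarith)
    · exact key (t - 1) w haw (by linarith)
  · rw [link_red_iterate_down hℓ hup, nb_link_down hℓ hup, nb_red_up hℓ (by grind),
      nb_blue_down hℓ (by grind), nb_link_up hℓ (by grind), nb_red_down hℓ (by grind),
      nb_blue_up hℓ (by grind), proj_eq_iff] at h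
    obtain ⟨w, h1, t, h2⟩ := h
    simp only [sub_add_cancel] at h1 h2
    have haw : (a : ℤ) = 2 * (-w) := by linarith
    refine ⟨by grind, fun h4 => ?_⟩
    subst h4
    push_cast at h2
    rcases stepSize_pred a ρ with ⟨e1, e2⟩ | ⟨e1, e2⟩ <;> rw [e1, e2] at h2
    · exact key (-t) (-w) haw (by linarith)
    · exact key (-t - 1) (-w) haw (by linarith)

/-- The left walk moves `a` rows, the right one two rows in the same direction, so `a ≡ 2` modulo 4;
displacements play no role. -/
theorem even_of_relation_blue (hℓ : Even ℓ) (x : Vertex 4 (8 * a))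
    (h : (fun y => nb a ℓ .red (nb a ℓ .blue (nb a ℓ .red (nb a ℓ .link y))))^[a] x =
      nb a ℓ .blue (nb a ℓ .red (nb a ℓ .blue (nb a ℓ .link (nb a ℓ .red (nb a ℓ .link x)))))) :
    Even a := by
  obtain ⟨⟨ρ, j⟩, -, -, rfl⟩ := exists_proj a ℓ x
  have hs (r) := odd_stepSize a r
  by_cases hup : Even (ρ + j)
  · obtain ⟨j', -, hj⟩ := link_red_blue_red_iterate_up (a := a) hℓ hup a
    rw [hj, nb_link_up hℓ hup, nb_red_down hℓ (by grind), nb_link_up hℓ (by grind),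
      nb_blue_down hℓ (by grind), nb_red_up hℓ (by grind), nb_blue_down hℓ (by grind),
      proj_eq_iff] at h
    obtain ⟨w, h1, -⟩ := h
    simp only at h1
    have : (a : ℤ) = 2 * (2 * w + 1) := by linarith
    grind
  · obtain ⟨j', -, hj⟩ := link_red_blue_red_iterate_down (a := a) hℓ hup a
    rw [hj, nb_link_down hℓ hup, nb_red_up hℓ (by grind), nb_link_down hℓ (by grind),
      nb_blue_up hℓ (by grind), nb_red_down hℓ (by grind), nb_blue_up hℓ (by grind),
      proj_eq_iff] at h
    obtain ⟨w, h1, -⟩ := h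
    simp only at h1
    have : (a : ℤ) = 2 * (1 - 2 * w) := by linarith
    grind

end

/-! ### Finite counts of short closed walks -/

instance : Fintype Color := ⟨{.red, .blue, .link}, fun c => by cases c <;> decide⟩

/-- Closed walks of length 8 for `ℓ = 4a`. As in the later counts with variable `a`, the generic
tests settle `6 ≤ a` and the smaller values are checked one by one. -/
theorem relClosedCount_edge_four_mul {a : ℕ} (ha : 2 ≤ a) (u e : Bool) (c : Color) :
    relClosedCount (isBase a 0 2) 7 u e [] c = if c = .link then 2 else 1 := by
  by_cases h : 6 ≤ a
  · exact relClosedCount_eq h (by revert u e c; decide +kernel) (by revert u e c; decide +kernel)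
  · interval_cases a <;> revert u e c <;> decide +kernel

theorem relClosedCount_edge_three (u e : Bool) (c : Color) :
    relClosedCount (isBase 3 0 1) 9 u e [] c = if c = .link then 14 else 13 := by
  revert u e c; decide +kernel

/-- Length 10 for `ℓ = 4`: this recognises red. -/
theorem relClosedCount_pair_four {a : ℕ} (ha : 3 ≤ a) (u e : Bool) (c c' : Color) (hc : c ≠ c') :
    relClosedCount (isBase a 4 0) 8 u e [c] c' = if c = .red ∨ c' = .red then 7 else 11 := by
  by_cases h : 6 ≤ a
  · exact relClosedCount_eq h (by revert u e c c'; decide +kernel)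
      (by revert u e c c'; decide +kernel)
  · interval_cases a <;> revert u e c c' <;> decide +kernel

/-- Across a red edge, this tells whether the edges before and after it have equal colours. -/
theorem relClosedCount_triple_four {a : ℕ} (ha : 3 ≤ a) (u e : Bool) (c c' : Color)
    (hc : c ≠ .red) (hc' : c' ≠ .red) :
    relClosedCount (isBase a 4 0) 7 u e [c, .red] c' = if c = c' then 4 else 3 := by
  by_cases h : 6 ≤ a
  · exact relClosedCount_eq h (by revert u e c c'; decide +kernel)
      (by revert u e c c'; decide +kernel)
  · interval_cases a <;> revert u e c c' <;> decide +kernel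

/-- Length 8 for `ℓ = 4 + 4a`: this recognises red. -/
theorem relClosedCount_pair_add_four {a : ℕ} (ha : 3 ≤ a) (u e : Bool) (c c' : Color)
    (hc : c ≠ c') :
    relClosedCount (isBase a 4 2) 6 u e [c] c' = if c = .red ∨ c' = .red then 0 else 1 := by
  by_cases h : 6 ≤ a
  · exact relClosedCount_eq h (by revert u e c c'; decide +kernel)
      (by revert u e c c'; decide +kernel)
  · interval_cases a <;> revert u e c c' <;> decide +kernel

/-- Here the comparison reaches only across two red edges, hence period two instead of one in the
pattern of exchanges. -/
theorem relClosedCount_path_add_four {a : ℕ} (ha : 3 ≤ a) (u e : Bool) (c c' c'' : Color)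
    (hc : c ≠ .red) (hc' : c' ≠ .red) (hc'' : c'' ≠ .red) :
    relClosedCount (isBase a 4 2) 5 u e [c, .red, c', .red] c'' = if c = c'' then 0 else 1 := by
  by_cases h : 6 ≤ a
  · exact relClosedCount_eq h (by revert u e c c' c''; decide +kernel)
      (by revert u e c c' c''; decide +kernel)
  · interval_cases a <;> revert u e c c' c'' <;> decide +kernel

/-! ### Invariance of `𝒞` for the excluded parameters -/

section

variable {a : ℕ} [NeZero a]

theorem colorMap_blue_ne_red {ℓ : ℤ} (ha : 2 ≤ a) (hℓ : Even ℓ)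
    (φ : specialGraph a ℓ ≃g specialGraph a ℓ) (hred : ∀ x, colorMap hℓ φ x .red = .red)
    (x : Vertex 4 (8 * a)) : colorMap hℓ φ x .blue ≠ .red := by
  rw [← hred x]
  exact (colorMap_injective ha hℓ φ x).ne (by decide)

theorem colorMap_link_eq {ℓ : ℤ} (ha : 2 ≤ a) (hℓ : Even ℓ)
    (φ : specialGraph a ℓ ≃g specialGraph a ℓ) (hred : ∀ x, colorMap hℓ φ x .red = .red)
    (x : Vertex 4 (8 * a)) (hb : colorMap hℓ φ x .blue = .blue) :
    colorMap hℓ φ x .link = .link := by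
  have hinj := colorMap_injective ha hℓ φ x
  have h1 := hinj.ne (show Color.red ≠ .link by decide)
  have h2 := hinj.ne (show Color.blue ≠ .link by decide)
  rw [hred] at h1
  rw [hb] at h2
  revert h1 h2
  generalize colorMap hℓ φ x .link = l
  cases l <;> simp

theorem twoFactorAutInvariant_half (ha : 2 ≤ a) :
    TwoFactorAutInvariant 4 (8 * a) ((2 * a + 1 : ℕ) : ZMod (8 * a)) ((4 * a : ℤ) : ZMod (8 * a)) := by
  have hℓ : Even (4 * a : ℤ) := by grind
  refine twoFactorAutInvariant_of_closedCount ha hℓ 7 2 fun x c => ?_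
  obtain ⟨u, e, h⟩ := closedCount_eq hℓ (show (4 * a : ℤ) = 0 + 2 * a * 2 by ring) x
  rw [h, relClosedCount_edge_four_mul ha]
  cases c <;> simp

theorem twoFactorAutInvariant_six :
    TwoFactorAutInvariant 4 (8 * 3) ((2 * 3 + 1 : ℕ) : ZMod (8 * 3)) ((6 : ℤ) : ZMod (8 * 3)) := by
  have hℓ : Even (6 : ℤ) := by decide
  refine twoFactorAutInvariant_of_closedCount (by norm_num) hℓ 9 14 fun x c => ?_
  obtain ⟨u, e, h⟩ := closedCount_eq hℓ (show (6 : ℤ) = 0 + 2 * (3 : ℕ) * 1 by norm_num) x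
  rw [h, relClosedCount_edge_three]
  cases c <;> simp

theorem twoFactorAutInvariant_four (ha : 3 ≤ a) (h4 : ¬ 4 ∣ a) :
    TwoFactorAutInvariant 4 (8 * a) ((2 * a + 1 : ℕ) : ZMod (8 * a)) ((4 : ℤ) : ZMod (8 * a)) := by
  have hℓ : Even (4 : ℤ) := by decide
  have ha2 : 2 ≤ a := by omega
  refine twoFactorAutInvariant_of_colorMap ha2 hℓ fun φ x => ?_
  by_contra hx
  have hcount := closedCount_eq (a := a) hℓ (show (4 : ℤ) = 4 + 2 * a * 0 by ring)
  have hred : ∀ x, colorMap hℓ φ x .red = .red := colorMap_red ha2 hℓ 8 11 (fun x c c' hc => by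
    obtain ⟨u, e, h⟩ := hcount x
    rw [h, relClosedCount_pair_four ha _ _ _ _ hc]
    split_ifs <;> simp <;> tauto) φ
  have hnr := colorMap_blue_ne_red ha2 hℓ φ hred
  have hstep' (x) : colorMap hℓ φ x .blue = colorMap hℓ φ (nb a 4 .red x) .blue := by
    have h1 := closedCount_map ha2 hℓ φ 7 (nb a 4 .blue x) [.blue, .red] .blue
    simp only [mapWord, List.foldl_cons, List.foldl_nil, nb_nb hℓ, colorMap_nb ha2 hℓ, hred] at h1
    have h0 : closedCount 4 7 (nb a 4 .blue x) [.blue, .red] .blue = 4 := by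
      obtain ⟨u, e, h⟩ := hcount (nb a 4 .blue x)
      rw [h, relClosedCount_triple_four ha _ _ _ _ (by decide) (by decide), if_pos rfl]
    rw [h0] at h1
    obtain ⟨u, e, h⟩ := hcount (φ (nb a 4 .blue x))
    rw [h, relClosedCount_triple_four ha _ _ _ _ (hnr _) (hnr _)] at h1
    by_contra hne
    rw [if_neg hne] at h1
    exact absurd h1 (by decide)
  have hstep (x) : colorMap hℓ φ (rowStep a 4 x) .blue = colorMap hℓ φ x .blue := by
    rw [rowStep, ← hstep', colorMap_nb ha2 hℓ]
  -- The pattern is constant along the row, so the second alternative would mean no exchange at `x`.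
  rcases exists_relation ha2 hℓ φ hred (fun x => by rw [hstep, hstep]) x hx with h | h
  · exact h4 ((even_of_relation_link hℓ _ h.2).2 rfl)
  · exact hx (colorMap_link_eq ha2 hℓ φ hred x ((hstep x).symm.trans h.1))

theorem twoFactorAutInvariant_add_four (ha : 3 ≤ a) (h2 : ¬ Even a) :
    TwoFactorAutInvariant 4 (8 * a) ((2 * a + 1 : ℕ) : ZMod (8 * a))
      ((4 + 4 * a : ℤ) : ZMod (8 * a)) := by
  have hℓ : Even (4 + 4 * a : ℤ) := by grind
  have ha2 : 2 ≤ a := by omega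
  refine twoFactorAutInvariant_of_colorMap ha2 hℓ fun φ x => ?_
  by_contra hx
  have hcount := closedCount_eq (a := a) hℓ (show (4 + 4 * a : ℤ) = 4 + 2 * a * 2 by ring)
  have hred : ∀ x, colorMap hℓ φ x .red = .red := colorMap_red ha2 hℓ 6 1 (fun x c c' hc => by
    obtain ⟨u, e, h⟩ := hcount x
    rw [h, relClosedCount_pair_add_four ha _ _ _ _ hc]
    split_ifs <;> simp <;> tauto) φ
  have hnr := colorMap_blue_ne_red ha2 hℓ φ hred
  have hper (x) : colorMap hℓ φ (rowStep a (4 + 4 * a) (rowStep a (4 + 4 * a) x)) .blue =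
      colorMap hℓ φ x .blue := by
    have h1 := closedCount_map ha2 hℓ φ 5 x [.blue, .red, .blue, .red] .blue
    obtain ⟨u, e, h⟩ := hcount x
    rw [h, relClosedCount_path_add_four ha _ _ _ _ _ (by decide) (by decide) (by decide),
      if_pos rfl] at h1
    obtain ⟨u, e, h⟩ := hcount (φ x)
    simp only [mapWord, List.foldl_cons, List.foldl_nil, hred] at h1
    rw [h, relClosedCount_path_add_four ha _ _ _ _ _ (hnr _) (hnr _) (hnr _)] at h1
    by_contra hne
    simp only [rowStep] at hne
    rw [if_neg (Ne.symm hne)] at h1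
    exact absurd h1 (by decide)
  rcases exists_relation ha2 hℓ φ hred hper x hx with h | h
  · exact h2 (even_of_relation_link hℓ _ h.2).1
  · exact h2 (even_of_relation_blue hℓ _ h.2)

end

/-! ### Changes of parameters as isomorphisms preserving rows -/

/-- `(k, ℓ)` and `(k', ℓ')` agree up to moves, and there is an isomorphism of the graphs which
preserves the rows. -/
def StronglyEquiv (n : ℕ) (k ℓ k' ℓ' : ZMod n) : Prop :=
  MoveEquiv 4 n k ℓ k' ℓ' ∧ ∃ e : graph 4 n k ℓ ≃g graph 4 n k' ℓ', ∀ v, (e v).1 = v.1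

theorem StronglyEquiv.refl {n : ℕ} (k ℓ : ZMod n) : StronglyEquiv n k ℓ k ℓ :=
  ⟨Relation.EqvGen.refl _, RelIso.refl _, fun _ => rfl⟩

theorem StronglyEquiv.symm {n : ℕ} {k ℓ k' ℓ' : ZMod n} (h : StronglyEquiv n k ℓ k' ℓ') :
    StronglyEquiv n k' ℓ' k ℓ := by
  obtain ⟨h, e, he⟩ := h
  refine ⟨Relation.EqvGen.symm _ _ h, e.symm, fun v => ?_⟩
  rw [← he, e.apply_symm_apply]

theorem StronglyEquiv.trans {n : ℕ} {k ℓ k' ℓ' k'' ℓ'' : ZMod n}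
    (h : StronglyEquiv n k ℓ k' ℓ') (h' : StronglyEquiv n k' ℓ' k'' ℓ'') :
    StronglyEquiv n k ℓ k'' ℓ'' := by
  obtain ⟨h, e, he⟩ := h
  obtain ⟨h', e', he'⟩ := h'
  exact ⟨Relation.EqvGen.trans _ _ _ h h', e.trans e', fun v => (he' _).trans (he v)⟩

/-- Conjugation by an isomorphism that preserves rows; a bare isomorphism of the graphs would not
suffice. -/
theorem StronglyEquiv.twoFactorAutInvariant {n : ℕ} {k ℓ k' ℓ' : ZMod n}
    (h : StronglyEquiv n k ℓ k' ℓ') (hinv : TwoFactorAutInvariant 4 n k' ℓ') :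
    TwoFactorAutInvariant 4 n k ℓ := by
  obtain ⟨-, e, he⟩ := h
  rw [twoFactorAutInvariant_iff] at hinv ⊢
  intro φ x x' hx
  have h1 := hinv ((e.symm.trans φ).trans e) (e x) (e x') (by rw [he, he, hx])
  have key (x) : ((e.symm.trans φ).trans e) (e x) = e (φ x) := by
    change e (φ (e.symm (e x))) = _
    rw [e.symm_apply_apply]
  rwa [key, key, he, he] at h1

theorem even_val_add {n : ℕ} [NeZero n] (hn : Even n) (x y : ZMod n) :
    Even (x + y).val ↔ (Even x.val ↔ Even y.val) := by
  have h := even_val_intCast hn ((x.val : ℤ) + y.val)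
  push_cast at h
  rw [ZMod.natCast_zmod_val, ZMod.natCast_zmod_val] at h
  rw [h, Int.even_add, Int.even_coe_nat, Int.even_coe_nat]

theorem even_val_neg {n : ℕ} [NeZero n] (hn : Even n) (x : ZMod n) :
    Even (-x).val ↔ Even x.val := by
  have h := even_val_intCast hn (-(x.val : ℤ))
  push_cast at h
  rw [ZMod.natCast_zmod_val] at h
  rw [h, even_neg, Int.even_coe_nat]

theorem nonLink_rel_or_iff {n : ℕ} (k : ZMod n) (u v : Vertex 4 n) :
    (v = (u.1, u.2 + signature 4 n k u.1) ∨ u = (v.1, v.2 + signature 4 n k v.1)) ↔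
      v.1 = u.1 ∧ (v.2 = u.2 + signature 4 n k u.1 ∨ v.2 = u.2 - signature 4 n k u.1) := by
  obtain ⟨i, j⟩ := u
  obtain ⟨i', j'⟩ := v
  simp only [Prod.mk.injEq]
  constructor
  · rintro (⟨rfl, rfl⟩ | ⟨rfl, rfl⟩)
    · exact ⟨rfl, Or.inl rfl⟩
    · exact ⟨rfl, Or.inr (by ring)⟩
  · rintro ⟨rfl, rfl | rfl⟩
    · exact Or.inl ⟨rfl, rfl⟩
    · exact Or.inr ⟨rfl, by ring⟩

theorem graph_adj_iff {n : ℕ} (k ℓ : ZMod n) (u v : Vertex 4 n) :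
    (graph 4 n k ℓ).Adj u v ↔ u ≠ v ∧ ((LinkRel 4 n ℓ u v ∨ LinkRel 4 n ℓ v u) ∨
      v.1 = u.1 ∧ (v.2 = u.2 + signature 4 n k u.1 ∨ v.2 = u.2 - signature 4 n k u.1)) := by
  rw [graph, SimpleGraph.sup_adj, linkGraph, nonLinkGraph, SimpleGraph.fromRel_adj,
    SimpleGraph.fromRel_adj, nonLink_rel_or_iff]
  tauto

/-- A bijection which preserves rows and is compatible with links and non-links. -/
theorem StronglyEquiv.of_equiv {n : ℕ} {k ℓ k' ℓ' : ZMod n} (h : MoveEquiv 4 n k ℓ k' ℓ')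
    (e : Vertex 4 n ≃ Vertex 4 n) (he : ∀ v, (e v).1 = v.1)
    (hl : ∀ u v, LinkRel 4 n ℓ' (e u) (e v) ↔ LinkRel 4 n ℓ u v)
    (hs : ∀ u v, v.1 = u.1 → (((e v).2 = (e u).2 + signature 4 n k' u.1 ∨
      (e v).2 = (e u).2 - signature 4 n k' u.1) ↔
      (v.2 = u.2 + signature 4 n k u.1 ∨ v.2 = u.2 - signature 4 n k u.1))) :
    StronglyEquiv n k ℓ k' ℓ' := by
  refine ⟨h, ⟨e, ?_⟩, he⟩
  intro u v
  rw [graph_adj_iff, graph_adj_iff, hl, hl, he, he, e.injective.ne_iff]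
  refine and_congr_right fun _ => or_congr_right (and_congr_right fun huv => hs u v huv)

theorem stronglyEquiv_neg_left {n : ℕ} (k ℓ : ZMod n) : StronglyEquiv n k ℓ (-k) ℓ := by
  refine .of_equiv (.rel _ _ (.neg_k k ℓ)) (Equiv.refl _) (fun _ => rfl) (fun _ _ => Iff.rfl) ?_
  intro u v _
  simp only [Equiv.refl_apply, signature]
  split_ifs
  · rfl
  · rw [or_comm, sub_neg_eq_add, ← sub_eq_add_neg]

theorem stronglyEquiv_neg_right {n : ℕ} [NeZero n] (hn : Even n) (k ℓ : ZMod n) :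
    StronglyEquiv n k ℓ k (-ℓ) := by
  refine .of_equiv (.rel _ _ (.neg_l k ℓ)) (Equiv.prodCongr (Equiv.refl _) (Equiv.neg _))
    (fun _ => rfl) ?_ ?_
  · rintro ⟨i, j⟩ ⟨i', j'⟩
    have h1 : (-j).val ≡ i.val [MOD 2] ↔ j.val ≡ i.val [MOD 2] := by
      have := even_val_neg hn j
      rw [Nat.even_iff, Nat.even_iff] at this
      unfold Nat.ModEq
      omega
    simp only [LinkRel, Equiv.prodCongr_apply, Prod.map_apply, Equiv.refl_apply, Equiv.neg_apply,
      Prod.mk.injEq, h1, neg_inj]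
    rw [← neg_add, neg_inj]
  · rintro ⟨i, j⟩ ⟨i', j'⟩ _
    simp only [Equiv.prodCongr_apply, Prod.map_apply, Equiv.refl_apply, Equiv.neg_apply]
    rw [or_comm]
    generalize signature 4 n k i = s
    constructor <;> rintro (h | h)
    · left; linear_combination -h
    · right; linear_combination -h
    · left; linear_combination -h
    · right; linear_combination -h

theorem even_val_iff_not {n : ℕ} [NeZero n] (hn : Even n) {k : ZMod n} (hk : ¬ Even k.val)
    (x y : ZMod n) (h : x = y + k ∨ x = y - k) : Even x.val ↔ ¬ Even y.val := by
  rcases h with rfl | rfl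
  · rw [even_val_add hn, iff_false_right hk]
  · rw [sub_eq_add_neg, even_val_add hn, even_val_neg hn, iff_false_right hk]

/-- The displacement along the rows which turns the parameter `k` into `k + n / 2`. -/
def halfTurn (n : ℕ) (v : Vertex 4 n) : ZMod n :=
  if v.1 = 1 ∧ ¬ Even v.2.val ∨ v.1 = 2 ∨ v.1 = 3 ∧ Even v.2.val then ((n / 2 : ℕ) : ZMod n) else 0

theorem half_add_half {n : ℕ} (hn : 2 ∣ n) :
    ((n / 2 : ℕ) : ZMod n) + ((n / 2 : ℕ) : ZMod n) = 0 := by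
  rw [← Nat.cast_add, ← two_mul, Nat.mul_div_cancel' hn, ZMod.natCast_self]

theorem even_val_half {n : ℕ} [NeZero n] (hn : 4 ∣ n) : Even ((n / 2 : ℕ) : ZMod n).val := by
  have h := even_val_intCast (n := n) (by obtain ⟨t, rfl⟩ := hn; grind) ((n / 2 : ℕ) : ℤ)
  rw [Int.cast_natCast] at h
  rw [h, Int.even_coe_nat]
  obtain ⟨t, rfl⟩ := hn
  exact ⟨t, by omega⟩

/-- In an odd row exactly one end of each non-link must be displaced by `n / 2`, in an even row both
or neither, and a link needs equal displacements at its ends. Starting with row 0 fixed, this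
determines `halfTurn` and closes up after four rows. As `4 ∣ n`, the displacement is even and keeps
all parities. -/
theorem stronglyEquiv_add_half {n : ℕ} [NeZero n] (hn : 4 ∣ n) (k ℓ : ZMod n)
    (hk : ¬ Even k.val) : StronglyEquiv n k ℓ (k + ((n / 2 : ℕ) : ZMod n)) ℓ := by
  have hn2 : Even n := by obtain ⟨t, rfl⟩ := hn; grind
  have hh := half_add_half hn2.two_dvd
  have hhe := even_val_half hn
  have hpar (v : Vertex 4 n) : Even (v.2 + halfTurn n v).val ↔ Even v.2.val := by
    rw [even_val_add hn2]
    unfold halfTurn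
    split_ifs
    · simp only [hhe, iff_true]
    · simp
  have hinv : Function.Involutive fun v : Vertex 4 n => (v.1, v.2 + halfTurn n v) := by
    intro v
    have h1 : halfTurn n (v.1, v.2 + halfTurn n v) = halfTurn n v := by
      rw [halfTurn]
      simp only [hpar]
      rfl
    simp only [h1]
    ext1
    · rfl
    · simp only
      have : halfTurn n v + halfTurn n v = 0 := by
        unfold halfTurn
        split_ifs
        · exact hh
        · simp
      rw [add_assoc, this, add_zero]
  have hval : ∀ i : ZMod 4, i = 0 ∧ i.val = 0 ∨ i = 1 ∧ i.val = 1 ∨ i = 2 ∧ i.val = 2 ∨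
    i = 3 ∧ i.val = 3 := by decide
  have d1 : (0 : ZMod 4) ≠ 1 := by decide
  have d2 : (0 : ZMod 4) ≠ 2 := by decide
  have d3 : (0 : ZMod 4) ≠ 3 := by decide
  have d4 : (1 : ZMod 4) ≠ 2 := by decide
  have d5 : (1 : ZMod 4) ≠ 3 := by decide
  have d6 : (2 : ZMod 4) ≠ 3 := by decide
  refine .of_equiv (.rel _ _ (.shift k ℓ hn (by norm_num))) hinv.toPerm (fun _ => rfl) ?_ ?_
  · rintro ⟨i, j⟩ ⟨i', j'⟩
    have hpu := hpar (i, j)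
    have hpv := hpar (i', j')
    have hp : (j + halfTurn n (i, j)).val ≡ i.val [MOD 2] ↔ j.val ≡ i.val [MOD 2] := by
      rw [Nat.even_iff, Nat.even_iff] at hpu
      simp only at hpu
      unfold Nat.ModEq
      omega
    simp only [Function.Involutive.coe_toPerm, LinkRel, hp, Prod.mk.injEq]
    refine and_congr_right fun hup => ?_
    have hup' : Even j.val ↔ Even i.val := by
      rw [Nat.even_iff, Nat.even_iff]
      unfold Nat.ModEq at hup
      omega
    refine or_congr (and_congr_right fun hi => and_congr_right fun hi' => ?_)
      (and_congr_right fun hi => and_congr_right fun hi' => ?_)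
    · have key (hjj : Even j'.val ↔ Even j.val) : halfTurn n (i', j') = halfTurn n (i, j) := by
        subst hi'
        unfold halfTurn
        rcases hval i with ⟨rfl, h⟩ | ⟨rfl, h⟩ | ⟨rfl, h⟩ | ⟨rfl, h⟩ <;> rw [h] at hup' hi <;>
          simp only [hjj, hup']
        all_goals first | omega | exact if_congr (by decide) rfl rfl
      constructor
      · intro h
        have hjj : Even j'.val ↔ Even j.val := by rw [← hpu, ← hpv]; simp only [h]
        rw [key hjj] at h
        exact add_right_cancel h
      · rintro rfl
        rw [key Iff.rfl]
    · have h3 : i = 3 := by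
        rcases hval i with ⟨rfl, h⟩ | ⟨rfl, h⟩ | ⟨rfl, h⟩ | ⟨rfl, h⟩ <;> rw [h] at hi <;>
          first | rfl | omega
      have e1 : halfTurn n (i', j') = 0 := by
        simp [halfTurn, hi', d1, d2, d3]
      have e2 : halfTurn n (i, j) = 0 := by
        subst h3
        have : ¬ Even j.val := by rw [hup']; decide
        simp [halfTurn, this, d5.symm, d6.symm]
      rw [e1, e2, add_zero, add_zero]
  · rintro ⟨i, j⟩ ⟨i', j'⟩ huv
    obtain rfl : i' = i := huv
    have hpu := hpar (i', j)
    have hpv := hpar (i', j')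
    simp only [Function.Involutive.coe_toPerm] at hpu hpv ⊢
    by_cases hi : Even i'.val
    · have e : halfTurn n (i', j') = halfTurn n (i', j) := by
        unfold halfTurn
        rcases hval i' with ⟨rfl, h⟩ | ⟨rfl, h⟩ | ⟨rfl, h⟩ | ⟨rfl, h⟩ <;> rw [h] at hi
        · simp [d1, d2, d3]
        · exact absurd hi (by decide)
        · simp
        · exact absurd hi (by decide)
      simp only [signature, hi, if_true, e]
      constructor <;> rintro (h | h)
      · left; linear_combination h
      · right; linear_combination h
      · left; linear_combination h
      · right; linear_combination h
    · have key (hjj : Even j'.val ↔ ¬ Even j.val) :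
          halfTurn n (i', j') + halfTurn n (i', j) = ((n / 2 : ℕ) : ZMod n) := by
        unfold halfTurn
        rcases hval i' with ⟨rfl, h⟩ | ⟨rfl, h⟩ | ⟨rfl, h⟩ | ⟨rfl, h⟩ <;> rw [h] at hi
        · exact absurd (by decide) hi
        · by_cases hj : Even j.val <;> simp [hjj, hj, d4, d5]
        · exact absurd (by decide) hi
        · by_cases hj : Even j.val <;> simp [hjj, hj, d5.symm, d6.symm]
      simp only [signature, hi, if_false]
      have par (x y : ZMod n) := even_val_iff_not hn2 hk x y
      have parh (x y : ZMod n) := even_val_iff_not hn2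
        (k := k + ((n / 2 : ℕ) : ZMod n)) (by rwa [even_val_add hn2, iff_true_right hhe]) x y
      have h2 : halfTurn n (i', j) + halfTurn n (i', j) = 0 := by
        unfold halfTurn
        split_ifs
        · exact hh
        · simp
      constructor <;> intro h
      · have hjj := parh _ _ h
        rw [hpu, hpv] at hjj
        have := key hjj
        rcases h with h | h
        · left; linear_combination h - this + h2
        · right; linear_combination h - this + h2 - hh
      · have := key (par _ _ h)
        rcases h with h | h
        · left; linear_combination h + this - h2
        · right; linear_combination h + this - h2 + hh

/-! ### The closing condition of a 10-cycle of type 3 -/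

/-- The link at the vertex leads to the next row. -/
def IsUp {m n : ℕ} (u : Vertex m n) : Prop := u.2.val ≡ u.1.val [MOD 2]

/-- The shift that occurs between the row `i` and the next row. -/
def rowShift (m : ℕ) {n : ℕ} (ℓ : ZMod n) (i : ZMod m) : ZMod n := if i.val + 1 = m then ℓ else 0

theorem linkRel_cases {m n : ℕ} [NeZero m] [NeZero n] (hm : Even m) (hm1 : 1 < m) (hn : Even n) {ℓ : ZMod n}
    (hℓ : Even ℓ.val) {u v : Vertex m n} (h : LinkRel m n ℓ u v) :
    IsUp u ∧ ¬ IsUp v ∧ v.1 = u.1 + 1 ∧ v.2 = u.2 + rowShift m ℓ u.1 := by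
  obtain ⟨i, j⟩ := u
  obtain ⟨hu, ⟨hi, rfl⟩ | ⟨hi, rfl⟩⟩ := h
  · refine ⟨hu, ?_, rfl, ?_⟩
    · unfold IsUp Nat.ModEq
      simp only at hu hi ⊢
      rw [ZMod.val_add_of_lt (by rwa [ZMod.val_one'' (by omega)]), ZMod.val_one'' (by omega)]
      unfold Nat.ModEq at hu
      omega
    · simp only [rowShift] at hi ⊢
      rw [if_neg hi.ne, add_zero]
  · refine ⟨hu, ?_, ?_, ?_⟩
    · have h1 := even_val_add hn j ℓ
      have h2 : ¬ Even i.val := by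
        intro h2; simp only at hi; rw [← hi] at hm; grind
      rw [iff_true_right hℓ] at h1
      unfold IsUp Nat.ModEq
      unfold Nat.ModEq at hu
      simp only [ZMod.val_zero] at hu ⊢
      rw [Nat.even_iff, Nat.even_iff] at h1
      rw [Nat.even_iff] at h2
      omega
    · simp only at hi ⊢
      have : ((i.val + 1 : ℕ) : ZMod m) = 0 := by rw [hi, ZMod.natCast_self]
      push_cast at this
      rw [ZMod.natCast_zmod_val] at this
      exact this.symm
    · simp only [rowShift] at hi ⊢
      rw [if_pos hi]

theorem linkGraph_cases {m n : ℕ} [NeZero m] [NeZero n] (hm : Even m) (hm1 : 1 < m) (hn : Even n)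
    {ℓ : ZMod n} (hℓ : Even ℓ.val) {u v : Vertex m n} (h : (linkGraph m n ℓ).Adj u v) :
    (IsUp u ∧ ¬ IsUp v ∧ v.1 = u.1 + 1 ∧ v.2 = u.2 + rowShift m ℓ u.1) ∨
      (IsUp v ∧ ¬ IsUp u ∧ u.1 = v.1 + 1 ∧ u.2 = v.2 + rowShift m ℓ v.1) := by
  obtain ⟨-, h | h⟩ := (SimpleGraph.fromRel_adj _ _ _).1 h
  · exact Or.inl (linkRel_cases hm hm1 hn hℓ h)
  · exact Or.inr (linkRel_cases hm hm1 hn hℓ h)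

theorem nonLinkGraph_cases {m n : ℕ} [NeZero n] (hn : Even n) {k : ZMod n} (hk : Odd k.val)
    {u v : Vertex m n} (h : (nonLinkGraph m n k).Adj u v) :
    (IsUp v ↔ ¬ IsUp u) ∧ v.1 = u.1 ∧
      ∃ e : ZMod n, (e = 1 ∨ e = -1) ∧ v.2 = u.2 + e * signature m n k u.1 := by
  have key : v.1 = u.1 ∧ (v.2 = u.2 + signature m n k u.1 ∨ v.2 = u.2 - signature m n k u.1) := by
    obtain ⟨-, h | h⟩ := (SimpleGraph.fromRel_adj _ _ _).1 h
    · rw [h]; exact ⟨rfl, Or.inl rfl⟩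
    · have h1 : u.1 = v.1 := by rw [h]
      refine ⟨h1.symm, Or.inr ?_⟩
      have h2 : u.2 = v.2 + signature m n k v.1 := congrArg Prod.snd h
      rw [h1, h2]; ring
  refine ⟨?_, key.1, ?_⟩
  · have hs : ¬ Even (signature m n k u.1).val := by
      unfold signature
      have h1 := even_val_intCast hn 1
      rw [Int.cast_one] at h1
      split_ifs
      · rw [h1]; decide
      · rwa [Nat.not_even_iff_odd]
    have := even_val_iff_not hn hs _ _ key.2
    unfold IsUp Nat.ModEq
    rw [Nat.even_iff, Nat.even_iff] at this
    rw [key.1]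
    omega
  · rcases key.2 with h | h
    · exact ⟨1, Or.inl rfl, by rw [h]; ring⟩
    · exact ⟨-1, Or.inr rfl, by rw [h]; ring⟩

/-- A change of sign between consecutive non-links would return to a vertex already visited. -/
theorem three_nonLinks {m n : ℕ} [NeZero n] (hn : Even n) {k : ZMod n} (hk : Odd k.val)
    {u₀ u₁ u₂ u₃ : Vertex m n} (h₀ : (nonLinkGraph m n k).Adj u₀ u₁)
    (h₁ : (nonLinkGraph m n k).Adj u₁ u₂) (h₂ : (nonLinkGraph m n k).Adj u₂ u₃)
    (h₀₂ : u₀ ≠ u₂) (h₁₃ : u₁ ≠ u₃) :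
    (IsUp u₃ ↔ ¬ IsUp u₀) ∧ u₃.1 = u₀.1 ∧
      ∃ e : ZMod n, (e = 1 ∨ e = -1) ∧ u₃.2 = u₀.2 + 3 * e * signature m n k u₀.1 := by
  obtain ⟨p₀, r₀, e₀, he₀, d₀⟩ := nonLinkGraph_cases hn hk h₀
  obtain ⟨p₁, r₁, e₁, he₁, d₁⟩ := nonLinkGraph_cases hn hk h₁
  obtain ⟨p₂, r₂, e₂, he₂, d₂⟩ := nonLinkGraph_cases hn hk h₂
  refine ⟨by tauto, by rw [r₂, r₁, r₀], e₀, he₀, ?_⟩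
  rw [r₀] at d₁
  rw [r₁, r₀] at d₂
  have e01 : e₁ = e₀ := by
    by_contra hne
    apply h₀₂
    refine Prod.ext (by rw [r₁, r₀]) ?_
    have : e₁ = -e₀ := by
      rcases he₀ with rfl | rfl <;> rcases he₁ with rfl | rfl <;> simp at hne ⊢
    rw [d₁, d₀, this]; ring
  have e12 : e₂ = e₁ := by
    by_contra hne
    apply h₁₃
    refine Prod.ext (by rw [r₂, r₁]) ?_
    have : e₂ = -e₁ := by
      rcases he₁ with rfl | rfl <;> rcases he₂ with rfl | rfl <;> simp at hne ⊢
    rw [d₂, d₁, this]; ring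
  rw [d₂, d₁, d₀, e12, e01]; ring

/-- The closing condition for a cycle of type 3. -/
def TypeThreeRelation (n : ℕ) (k ℓ : ZMod n) : Prop :=
  ∃ e₀ e₁ e₂ e₃ : ZMod n, (e₀ = 1 ∨ e₀ = -1) ∧ (e₁ = 1 ∨ e₁ = -1) ∧ (e₂ = 1 ∨ e₂ = -1) ∧
    (e₃ = 1 ∨ e₃ = -1) ∧
    (ℓ = 3 * e₀ + e₁ * k + e₂ + e₃ * k ∨ ℓ = 3 * e₀ * k + e₁ + e₂ * k + e₃)

/-- Among four consecutive rows exactly one carries the shift `ℓ`, and the signature alternates;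
only the parity of `i` distinguishes the two forms. -/
theorem TypeThreeRelation.of_sum {n : ℕ} {k ℓ : ZMod n} (i : ZMod 4) {e₀ e₁ e₂ e₃ : ZMod n}
    (h₀ : e₀ = 1 ∨ e₀ = -1) (h₁ : e₁ = 1 ∨ e₁ = -1) (h₂ : e₂ = 1 ∨ e₂ = -1)
    (h₃ : e₃ = 1 ∨ e₃ = -1)
    (h : rowShift 4 ℓ i + rowShift 4 ℓ (i + 1) + rowShift 4 ℓ (i + 2) + rowShift 4 ℓ (i + 3) =
      3 * e₀ * signature 4 n k i + e₁ * signature 4 n k (i + 1) + e₂ * signature 4 n k (i + 2) +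
        e₃ * signature 4 n k (i + 3)) : TypeThreeRelation n k ℓ := by
  refine ⟨e₀, e₁, e₂, e₃, h₀, h₁, h₂, h₃, ?_⟩
  have hl : rowShift 4 ℓ i + rowShift 4 ℓ (i + 1) + rowShift 4 ℓ (i + 2) +
      rowShift 4 ℓ (i + 3) = ℓ := by
    have hval : ∀ i : ZMod 4,
      (i.val + 1 = 4 ∧ (i + 1).val + 1 ≠ 4 ∧ (i + 2).val + 1 ≠ 4 ∧ (i + 3).val + 1 ≠ 4) ∨
      (i.val + 1 ≠ 4 ∧ (i + 1).val + 1 = 4 ∧ (i + 2).val + 1 ≠ 4 ∧ (i + 3).val + 1 ≠ 4) ∨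
      (i.val + 1 ≠ 4 ∧ (i + 1).val + 1 ≠ 4 ∧ (i + 2).val + 1 = 4 ∧ (i + 3).val + 1 ≠ 4) ∨
      (i.val + 1 ≠ 4 ∧ (i + 1).val + 1 ≠ 4 ∧ (i + 2).val + 1 ≠ 4 ∧ (i + 3).val + 1 = 4) := by
      decide
    unfold rowShift
    rcases hval i with ⟨p, q, r, s⟩ | ⟨p, q, r, s⟩ | ⟨p, q, r, s⟩ | ⟨p, q, r, s⟩ <;>
      simp [p, q, r, s]
  rw [hl] at h
  have hval : ∀ i : ZMod 4,
    (Even i.val ∧ ¬ Even (i + 1).val ∧ Even (i + 2).val ∧ ¬ Even (i + 3).val) ∨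
    (¬ Even i.val ∧ Even (i + 1).val ∧ ¬ Even (i + 2).val ∧ Even (i + 3).val) := by decide
  unfold signature at h
  rcases hval i with ⟨p, q, r, s⟩ | ⟨p, q, r, s⟩
  · left
    simp only [p, q, r, s, if_true, if_false] at h
    rw [h]; ring
  · right
    simp only [p, q, r, s, if_true, if_false] at h
    rw [h]; ring

theorem eq_four_of_hasTenCycleOfTypeThree {m n : ℕ} {k ℓ : ZMod n} (hm4 : 4 ≤ m) (hm : Even m)
    (hn0 : n ≠ 0) (hn : Even n) (hk : Odd k.val) (hℓ : Even ℓ.val)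
    (h : HasTenCycleOfTypeThree m n k ℓ) : m = 4 ∧ TypeThreeRelation n k ℓ := by
  have : NeZero m := ⟨by omega⟩
  have : NeZero n := ⟨hn0⟩
  obtain ⟨v, ⟨hinj, hadj⟩, hcode⟩ := h
  have hlink (j : Fin 10) (hj : (![1, 1, 1, 0, 1, 0, 1, 0, 1, 0] : Fin 10 → ℕ) j = 0) :
      (linkGraph m n ℓ).Adj (v j) (v (j + 1)) := by
    rw [← hcode, tenCycleCode] at hj
    by_contra hc
    simp [hc] at hj
  have hnon (j : Fin 10) (hj : (![1, 1, 1, 0, 1, 0, 1, 0, 1, 0] : Fin 10 → ℕ) j = 1) :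
      (nonLinkGraph m n k).Adj (v j) (v (j + 1)) := by
    rw [← hcode, tenCycleCode] at hj
    refine ((SimpleGraph.sup_adj _ _ _ _).1 (hadj j)).resolve_left fun hc => ?_
    simp [hc] at hj
  obtain ⟨p₀, r₀, e₀, he₀, d₀⟩ := three_nonLinks hn hk (hnon 0 rfl) (hnon 1 rfl) (hnon 2 rfl)
    (hinj.ne (by decide)) (hinj.ne (by decide))
  obtain ⟨p₁, r₁, e₁, he₁, d₁⟩ := nonLinkGraph_cases hn hk (hnon 4 rfl)
  obtain ⟨p₂, r₂, e₂, he₂, d₂⟩ := nonLinkGraph_cases hn hk (hnon 6 rfl)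
  obtain ⟨p₃, r₃, e₃, he₃, d₃⟩ := nonLinkGraph_cases hn hk (hnon 8 rfl)
  have l₀ := linkGraph_cases hm (by omega) hn hℓ (hlink 3 rfl)
  have l₁ := linkGraph_cases hm (by omega) hn hℓ (hlink 5 rfl)
  have l₂ := linkGraph_cases hm (by omega) hn hℓ (hlink 7 rfl)
  have l₃ := linkGraph_cases hm (by omega) hn hℓ (hlink 9 rfl)
  simp only [Fin.reduceAdd] at p₀ r₀ d₀ p₁ r₁ d₁ p₂ r₂ d₂ p₃ r₃ d₃ l₀ l₁ l₂ l₃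
  have hfour (h4 : (4 : ZMod m) = 0) : m = 4 := by
    have h5 : ((4 : ℕ) : ZMod m) = 0 := by exact_mod_cast h4
    exact le_antisymm (Nat.le_of_dvd (by norm_num) ((ZMod.natCast_eq_zero_iff 4 m).1 h5)) hm4
  have hneg {e : ZMod n} (he : e = 1 ∨ e = -1) : -e = 1 ∨ -e = -1 := by
    rcases he with rfl | rfl
    · exact Or.inr rfl
    · exact Or.inl (neg_neg 1)
  -- Each link and each odd run of non-links reverses `IsUp`, so the direction of the first link is
  -- that of all four.
  by_cases hup : IsUp (v 3)
  · obtain ⟨-, q₀, a₀, b₀⟩ := l₀.resolve_right fun h => h.2.1 hup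
    obtain ⟨-, q₁, a₁, b₁⟩ := l₁.resolve_right fun h => h.2.1 (p₁.2 q₀)
    obtain ⟨-, q₂, a₂, b₂⟩ := l₂.resolve_right fun h => h.2.1 (p₂.2 q₁)
    obtain ⟨-, q₃, a₃, b₃⟩ := l₃.resolve_right fun h => h.2.1 (p₃.2 q₂)
    have hm4 : m = 4 := hfour (by linear_combination -(r₀ + a₀ + r₁ + a₁ + r₂ + a₂ + r₃ + a₃))
    subst hm4
    refine ⟨rfl, .of_sum (v 0).1 (hneg he₀) (hneg he₁) (hneg he₂) (hneg he₃) ?_⟩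
    have c₁ : (v 4).1 = (v 0).1 + 1 := by linear_combination r₀ + a₀
    have c₂ : (v 6).1 = (v 0).1 + 2 := by linear_combination r₀ + a₀ + r₁ + a₁
    have c₃ : (v 8).1 = (v 0).1 + 3 := by linear_combination r₀ + a₀ + r₁ + a₁ + r₂ + a₂
    rw [r₀] at b₀
    rw [r₁, c₁] at b₁
    rw [r₂, c₂] at b₂
    rw [r₃, c₃] at b₃
    rw [c₁] at d₁
    rw [c₂] at d₂
    rw [c₃] at d₃
    linear_combination -(d₀ + b₀ + d₁ + b₁ + d₂ + b₂ + d₃ + b₃)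
  · obtain ⟨q₀, -, a₀, b₀⟩ := l₀.resolve_left fun h => hup h.1
    obtain ⟨q₁, -, a₁, b₁⟩ := l₁.resolve_left fun h => p₁.1 h.1 q₀
    obtain ⟨q₂, -, a₂, b₂⟩ := l₂.resolve_left fun h => p₂.1 h.1 q₁
    obtain ⟨q₃, -, a₃, b₃⟩ := l₃.resolve_left fun h => p₃.1 h.1 q₂
    have hm4 : m = 4 := hfour (by linear_combination r₀ - a₀ + r₁ - a₁ + r₂ - a₂ + r₃ - a₃)
    subst hm4
    -- Going down, the rows are met in the order `i, i + 3, i + 2, i + 1`.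
    refine ⟨rfl, .of_sum (v 0).1 he₀ he₃ he₂ he₁ ?_⟩
    have h4 : (4 : ZMod 4) = 0 := by decide
    have c₁ : (v 4).1 = (v 0).1 + 3 := by linear_combination r₀ - a₀ - h4
    have c₂ : (v 6).1 = (v 0).1 + 2 := by linear_combination r₀ - a₀ + r₁ - a₁ - h4
    have c₃ : (v 8).1 = (v 0).1 + 1 := by linear_combination r₀ - a₀ + r₁ - a₁ + r₂ - a₂ - h4
    rw [c₁] at b₀ d₁
    rw [c₂] at b₁ d₂
    rw [c₃] at b₂ d₃
    linear_combination d₀ - b₀ + d₁ - b₁ + d₂ - b₂ + d₃ - b₃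

theorem TypeThreeRelation.neg {n : ℕ} {k ℓ : ZMod n} (h : TypeThreeRelation n k ℓ) :
    TypeThreeRelation n (-k) ℓ := by
  have hneg {e : ZMod n} (he : e = 1 ∨ e = -1) : -e = 1 ∨ -e = -1 := by
    rcases he with rfl | rfl
    · exact Or.inr rfl
    · exact Or.inl (neg_neg 1)
  obtain ⟨e₀, e₁, e₂, e₃, h₀, h₁, h₂, h₃, h | h⟩ := h
  · exact ⟨e₀, -e₁, e₂, -e₃, h₀, hneg h₁, h₂, hneg h₃, Or.inl (by rw [h]; ring)⟩
  · exact ⟨-e₀, e₁, -e₂, e₃, hneg h₀, h₁, hneg h₂, h₃, Or.inr (by rw [h]; ring)⟩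

/-- The total coefficient of `k` is even in both forms of the relation. -/
theorem TypeThreeRelation.add {n : ℕ} {k ℓ : ZMod n} (h : TypeThreeRelation n k ℓ) (t : ZMod n)
    (ht : t + t = 0) : TypeThreeRelation n (k + t) ℓ := by
  obtain ⟨e₀, e₁, e₂, e₃, h₀, h₁, h₂, h₃, h⟩ := h
  refine ⟨e₀, e₁, e₂, e₃, h₀, h₁, h₂, h₃, h.imp (fun h => ?_) (fun h => ?_)⟩
  · have : e₁ * t + e₃ * t = 0 := by
      rcases h₁ with rfl | rfl <;> rcases h₃ with rfl | rfl
      · linear_combination ht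
      · ring
      · ring
      · linear_combination -ht
    linear_combination h - this
  · have : 3 * e₀ * t + e₂ * t = 0 := by
      rcases h₀ with rfl | rfl <;> rcases h₂ with rfl | rfl
      · linear_combination 2 * ht
      · linear_combination ht
      · linear_combination -ht
      · linear_combination -2 * ht
    linear_combination h - this

theorem TypeThreeRelation.cases {n : ℕ} {A ℓ : ZMod n} (hA : 8 * A = 0)
    (h : TypeThreeRelation n (2 * A + 1) ℓ) :
    ∃ ℓ', (ℓ = ℓ' ∨ ℓ = -ℓ') ∧ (ℓ' = 4 * A ∨ ℓ' = 4 + 4 * A ∨ ℓ' = 4 ∨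
      ℓ' = 2 ∨ ℓ' = 2 + 4 * A ∨ ℓ' = 6 ∨ ℓ' = 6 + 4 * A) := by
  obtain ⟨e₀, e₁, e₂, e₃, h₀, h₁, h₂, h₃, h⟩ := h
  -- Each choice of signs is described by an overall sign `c` and the multiple `d` of `8A = 0` to be
  -- discarded.
  have fin (ℓ' c d : ZMod n) (hc : c = 1 ∨ c = -1) (hd : ℓ = c * ℓ' + d * (8 * A))
      (hl : ℓ' = 4 * A ∨ ℓ' = 4 + 4 * A ∨ ℓ' = 4 ∨
        ℓ' = 2 ∨ ℓ' = 2 + 4 * A ∨ ℓ' = 6 ∨ ℓ' = 6 + 4 * A) :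
      ∃ ℓ', (ℓ = ℓ' ∨ ℓ = -ℓ') ∧ (ℓ' = 4 * A ∨ ℓ' = 4 + 4 * A ∨ ℓ' = 4 ∨
        ℓ' = 2 ∨ ℓ' = 2 + 4 * A ∨ ℓ' = 6 ∨ ℓ' = 6 + 4 * A) := by
    refine ⟨ℓ', ?_, hl⟩
    rw [hA, mul_zero, add_zero] at hd
    rcases hc with rfl | rfl
    · exact Or.inl (by rw [hd]; ring)
    · exact Or.inr (by rw [hd]; ring)
  rcases h with h | h <;> rcases h₀ with rfl | rfl <;> rcases h₁ with rfl | rfl <;>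
    rcases h₂ with rfl | rfl <;> rcases h₃ with rfl | rfl
  · exact fin (6 + 4 * A) 1 0 (.inl rfl) (by linear_combination h) (.inr (.inr (.inr (.inr (.inr (.inr rfl))))))
  · exact fin (4) 1 0 (.inl rfl) (by linear_combination h) (.inr (.inr (.inl rfl)))
  · exact fin (4 + 4 * A) 1 0 (.inl rfl) (by linear_combination h) (.inr (.inl rfl))
  · exact fin (2) 1 0 (.inl rfl) (by linear_combination h) (.inr (.inr (.inr (.inl rfl))))
  · exact fin (4) 1 0 (.inl rfl) (by linear_combination h) (.inr (.inr (.inl rfl)))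
  · exact fin (2 + 4 * A) 1 (-1) (.inl rfl) (by linear_combination h) (.inr (.inr (.inr (.inr (.inl rfl)))))
  · exact fin (2) 1 0 (.inl rfl) (by linear_combination h) (.inr (.inr (.inr (.inl rfl))))
  · exact fin (4 * A) 1 (-1) (.inl rfl) (by linear_combination h) (.inl rfl)
  · exact fin (4 * A) 1 0 (.inl rfl) (by linear_combination h) (.inl rfl)
  · exact fin (2) (-1) 0 (.inr rfl) (by linear_combination h) (.inr (.inr (.inr (.inl rfl))))
  · exact fin (2 + 4 * A) (-1) 1 (.inr rfl) (by linear_combination h) (.inr (.inr (.inr (.inr (.inl rfl)))))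
  · exact fin (4) (-1) 0 (.inr rfl) (by linear_combination h) (.inr (.inr (.inl rfl)))
  · exact fin (2) (-1) 0 (.inr rfl) (by linear_combination h) (.inr (.inr (.inr (.inl rfl))))
  · exact fin (4 + 4 * A) (-1) 0 (.inr rfl) (by linear_combination h) (.inr (.inl rfl))
  · exact fin (4) (-1) 0 (.inr rfl) (by linear_combination h) (.inr (.inr (.inl rfl)))
  · exact fin (6 + 4 * A) (-1) 0 (.inr rfl) (by linear_combination h) (.inr (.inr (.inr (.inr (.inr (.inr rfl))))))
  · exact fin (6) 1 1 (.inl rfl) (by linear_combination h) (.inr (.inr (.inr (.inr (.inr (.inl rfl))))))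
  · exact fin (4) 1 1 (.inl rfl) (by linear_combination h) (.inr (.inr (.inl rfl)))
  · exact fin (4 + 4 * A) 1 0 (.inl rfl) (by linear_combination h) (.inr (.inl rfl))
  · exact fin (2 + 4 * A) 1 0 (.inl rfl) (by linear_combination h) (.inr (.inr (.inr (.inr (.inl rfl)))))
  · exact fin (4) 1 1 (.inl rfl) (by linear_combination h) (.inr (.inr (.inl rfl)))
  · exact fin (2) 1 1 (.inl rfl) (by linear_combination h) (.inr (.inr (.inr (.inl rfl))))
  · exact fin (2 + 4 * A) 1 0 (.inl rfl) (by linear_combination h) (.inr (.inr (.inr (.inr (.inl rfl)))))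
  · exact fin (4 * A) 1 0 (.inl rfl) (by linear_combination h) (.inl rfl)
  · exact fin (4 * A) 1 (-1) (.inl rfl) (by linear_combination h) (.inl rfl)
  · exact fin (2 + 4 * A) (-1) 0 (.inr rfl) (by linear_combination h) (.inr (.inr (.inr (.inr (.inl rfl)))))
  · exact fin (2) (-1) (-1) (.inr rfl) (by linear_combination h) (.inr (.inr (.inr (.inl rfl))))
  · exact fin (4) (-1) (-1) (.inr rfl) (by linear_combination h) (.inr (.inr (.inl rfl)))
  · exact fin (2 + 4 * A) (-1) 0 (.inr rfl) (by linear_combination h) (.inr (.inr (.inr (.inr (.inl rfl)))))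
  · exact fin (4 + 4 * A) (-1) 0 (.inr rfl) (by linear_combination h) (.inr (.inl rfl))
  · exact fin (4) (-1) (-1) (.inr rfl) (by linear_combination h) (.inr (.inr (.inl rfl)))
  · exact fin (6) (-1) (-1) (.inr rfl) (by linear_combination h) (.inr (.inr (.inr (.inr (.inr (.inl rfl))))))

/-! ### Normal form of the parameters and conclusion -/

theorem exists_normal_form {n : ℕ} (hn : Even n) {K : ℤ} (hK : Odd K) (h4 : (n : ℤ) ∣ 4 * K - 4)
    (h2 : ¬ (n : ℤ) ∣ 2 * K - 2) : ∃ (a : ℕ) (t : ℤ), n = 8 * a ∧ Odd t ∧ K = 1 + 2 * a * t := by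
  obtain ⟨t, ht⟩ := h4
  obtain ⟨b, rfl⟩ := hn
  obtain ⟨c, rfl⟩ := hK
  have hodd : Odd t := by
    rw [← Int.not_even_iff_odd]
    rintro ⟨s, rfl⟩
    exact h2 ⟨s, by push_cast at ht ⊢; linarith⟩
  obtain ⟨r, hr⟩ := id hodd
  obtain ⟨a, rfl⟩ : 4 ∣ b := by
    have : (4 : ℤ) ∣ b := by
      -- From `bt = 4c` and `t² = 1 + 4(r² + r)`: `b = t(bt) - b(t² - 1)`.
      refine ⟨c * t - b * (r ^ 2 + r), ?_⟩
      have h1 : (b : ℤ) * t = 4 * c := by push_cast at ht; linarith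
      have h2 : t * t = 1 + 4 * (r ^ 2 + r) := by rw [hr]; ring
      linear_combination t * h1 - b * h2
    exact_mod_cast this
  exact ⟨a, t, by ring, hodd, by push_cast at ht; linarith⟩

theorem exists_stronglyEquiv {n : ℕ} (hn14 : 14 ≤ n) (hn : Even n) {k ℓ : ZMod n}
    (hk : Odd k.val) (hℓ : Even ℓ.val) (h2 : 2 * k ≠ 2) (h2' : 2 * k ≠ -2)
    (hkℓ : ℓ * k = ℓ ∨ ℓ * k = -ℓ) (h4 : 4 * k = 4 ∨ 4 * k = -4)
    (h : TypeThreeRelation n k ℓ) :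
    ∃ a : ℕ, n = 8 * a ∧ StronglyEquiv n k ℓ ((2 * a + 1 : ℕ) : ZMod n) ℓ ∧
      TypeThreeRelation n (2 * (a : ZMod n) + 1) ℓ ∧
      (ℓ * (2 * (a : ZMod n) + 1) = ℓ ∨ ℓ * (2 * (a : ZMod n) + 1) = -ℓ) := by
  have : NeZero n := ⟨by omega⟩
  wlog h4' : 4 * k = 4 generalizing k
  · have hk' : Odd (-k).val := by
      rw [← Nat.not_even_iff_odd] at hk ⊢
      rwa [even_val_neg hn]
    obtain ⟨a, ha, h5, h6⟩ := this (k := -k) hk' (fun h' => h2' (by linear_combination -h'))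
      (fun h' => h2 (by linear_combination -h'))
      (hkℓ.symm.imp (fun h' => by linear_combination -h') (fun h' => by linear_combination -h'))
      (.inl (by linear_combination -(h4.resolve_left h4'))) h.neg
      (by linear_combination -(h4.resolve_left h4'))
    exact ⟨a, ha, (stronglyEquiv_neg_left k ℓ).trans h5, h6⟩
  obtain ⟨a, t, rfl, ht, hK⟩ := exists_normal_form hn (K := k.val)
    (by exact_mod_cast hk) (by
      rw [← ZMod.intCast_zmod_eq_zero_iff_dvd]
      push_cast
      rw [ZMod.natCast_zmod_val, h4', sub_self]) (by
      rw [← ZMod.intCast_zmod_eq_zero_iff_dvd]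
      push_cast
      rw [ZMod.natCast_zmod_val, sub_eq_zero]
      exact h2)
  have hk1 : k = 1 + 2 * (a : ZMod (8 * a)) * t := by
    have := congrArg (fun z : ℤ => (z : ZMod (8 * a))) hK
    push_cast at this
    rwa [ZMod.natCast_zmod_val] at this
  have h8 : (8 : ZMod (8 * a)) * a = 0 := by exact_mod_cast ZMod.natCast_self (8 * a)
  have hhalf : ((8 * a / 2 : ℕ) : ZMod (8 * a)) = 4 * a := by
    rw [show 8 * a / 2 = 4 * a by omega]; push_cast; rfl
  -- Modulo `8a`, `2at` is `2a` or `6a`; the second becomes `2a` by adding `n / 2 = 4a`.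
  obtain ⟨s, hs⟩ : ∃ s, t = 4 * s + 1 ∨ t = 4 * s + 3 := by
    obtain ⟨r, rfl⟩ := ht
    exact ⟨r / 2, by omega⟩
  refine ⟨a, rfl, ?_⟩
  rcases hs with rfl | rfl
  · have hk2 : k = 2 * (a : ZMod (8 * a)) + 1 := by
      push_cast at hk1
      linear_combination hk1 + s * h8
    push_cast
    rw [← hk2]
    exact ⟨.refl _ _, h, hkℓ⟩
  · have hk2 : k + 4 * a = 2 * (a : ZMod (8 * a)) + 1 := by
      push_cast at hk1
      linear_combination hk1 + (s + 1) * h8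
    push_cast
    rw [← hk2]
    refine ⟨?_, h.add _ (by linear_combination h8), ?_⟩
    · have := stronglyEquiv_add_half (n := 8 * a) ⟨2 * a, by ring⟩ k ℓ (Nat.not_even_iff_odd.2 hk)
      rwa [hhalf] at this
    · obtain ⟨r, hr⟩ := hℓ
      have hℓr : ℓ = r + r := by
        have := congrArg (fun z : ℕ => (z : ZMod (8 * a))) hr
        push_cast at this
        rwa [ZMod.natCast_zmod_val] at this
      have h0 : ℓ * (4 * a) = 0 := by rw [hℓr]; linear_combination r * h8
      rw [mul_add, h0, add_zero]
      exact hkℓ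

/-- The sign `+` would give `4 ∣ L`, which fails. The sign `-` gives `L(a + 1) = 4ad`, hence `a ∣ 1`
or `a ∣ 3`. -/
theorem eq_three_of_mul_eq {a : ℕ} (ha : 2 ≤ a) {L : ℤ}
    (hL : L = 2 ∨ L = 2 + 4 * a ∨ L = 6 ∨ L = 6 + 4 * a)
    (h : (L : ZMod (8 * a)) * (2 * (a : ZMod (8 * a)) + 1) = L ∨
      (L : ZMod (8 * a)) * (2 * (a : ZMod (8 * a)) + 1) = -L) :
    a = 3 ∧ (L = 6 ∨ L = 18) := by
  have ha0 : (a : ℤ) ≠ 0 := by positivity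
  have key : (((8 * a : ℕ) : ℤ) ∣ L * (2 * a)) ∨ (((8 * a : ℕ) : ℤ) ∣ L * (2 * a + 2)) := by
    refine h.imp (fun h => ?_) (fun h => ?_)
    · rw [← ZMod.intCast_zmod_eq_zero_iff_dvd]
      push_cast
      linear_combination h
    · rw [← ZMod.intCast_zmod_eq_zero_iff_dvd]
      push_cast
      linear_combination h
  rcases key with ⟨d, hd⟩ | ⟨d, hd⟩
  · have h1 : L = 4 * d := by
      have : (2 * a : ℤ) * (L - 4 * d) = 0 := by push_cast at hd; linear_combination hd
      have := (mul_eq_zero.1 this).resolve_left (by positivity)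
      linarith
    omega
  · have h1 : L * (a + 1) = 4 * a * d := by push_cast at hd; linarith
    have h3 (u c : ℤ) (h : a * u = c) (hc : c = 1 ∨ c = 3) : a = 3 ∧ c = 3 := by
      have hd : (a : ℤ) ∣ c := ⟨u, h.symm⟩
      have hle := Int.le_of_dvd (by omega) hd
      have ha3 : a ≤ 3 := by omega
      interval_cases a <;> omega
    rcases hL with rfl | rfl | rfl | rfl
    · have := h3 (2 * d - 1) 1 (by linarith) (.inl rfl)
      omega
    · have := h3 (2 * d - 2 * a - 3) 1 (by linarith) (.inl rfl)
      omega
    · have := h3 (2 * d - 3) 3 (by linarith) (.inr rfl)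
      omega
    · have := h3 (2 * d - 2 * a - 5) 3 (by linarith) (.inr rfl)
      omega

theorem conclusion_of_stronglyEquiv {n : ℕ} (hn14 : 14 ≤ n) {k ℓ : ZMod n}
    (hC : ¬ TwoFactorAutInvariant 4 n k ℓ) {a : ℕ} (ha : n = 8 * a) {L : ℤ}
    (he : StronglyEquiv n k ℓ ((2 * a + 1 : ℕ) : ZMod n) (L : ZMod n))
    (hL : L = 4 * a ∨ L = 4 + 4 * a ∨ L = 4 ∨ a = 3 ∧ L = 6) :
    ∃ n₀ : ℕ, 1 ≤ n₀ ∧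
      (n = 16 * n₀ ∧
          StronglyEquiv n k ℓ ((4 * n₀ + 1 : ℕ) : ZMod n) ((8 * n₀ + 4 : ℕ) : ZMod n) ∨
        n = 32 * n₀ ∧ StronglyEquiv n k ℓ ((8 * n₀ + 1 : ℕ) : ZMod n) 4) := by
  subst ha
  have ha2 : 2 ≤ a := by omega
  have : NeZero a := ⟨by omega⟩
  have : NeZero (8 * a) := ⟨by omega⟩
  rcases hL with rfl | rfl | rfl | ⟨rfl, rfl⟩
  · exact absurd (he.twoFactorAutInvariant (twoFactorAutInvariant_half ha2)) hC
  · by_cases h2 : Even a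
    · obtain ⟨b, rfl⟩ := h2
      refine ⟨b, by omega, .inl ⟨by ring, ?_⟩⟩
      convert he using 1
      · congr 1; ring
      · push_cast; ring
    · have : a ≠ 2 := by rintro rfl; exact h2 (by decide)
      exact absurd (he.twoFactorAutInvariant (twoFactorAutInvariant_add_four (by omega) h2)) hC
  · by_cases h4 : 4 ∣ a
    · obtain ⟨b, rfl⟩ := h4
      refine ⟨b, by omega, .inr ⟨by ring, ?_⟩⟩
      convert he using 1
      · congr 1; ring
      · push_cast; rfl
    · by_cases h2 : a = 2
      · subst h2
        -- Here `n = 16`, `k = 5` and `-4 = 12`, the first family with `n₀ = 1`.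
        exact ⟨1, le_rfl, .inl ⟨rfl, he.trans (stronglyEquiv_neg_right (by decide) _ _)⟩⟩
      · exact absurd (he.twoFactorAutInvariant (twoFactorAutInvariant_four (by omega) h4)) hC
  · exact absurd (he.twoFactorAutInvariant twoFactorAutInvariant_six) hC

end Xa

theorem mainTheorem7 (m n : ℕ) (k ℓ : ZMod n)
    (hadm : Xa.Admissible m n k ℓ) (hn : 14 ≤ n)
    (hk : 4 * k = 4 ∨ 4 * k = -4)
    (hC : ¬ Xa.TwoFactorAutInvariant m n k ℓ)
    (h3 : Xa.HasTenCycleOfTypeThree m n k ℓ) :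
    ∃ n₀ : ℕ, 1 ≤ n₀ ∧ m = 4 ∧
      ((n = 16 * n₀ ∧
          Xa.MoveEquiv m n k ℓ ((4 * n₀ + 1 : ℕ) : ZMod n) ((8 * n₀ + 4 : ℕ) : ZMod n) ∧
          Nonempty (Xa.graph m n k ℓ ≃g
            Xa.graph 4 (16 * n₀) ((4 * n₀ + 1 : ℕ) : ZMod (16 * n₀))
              ((8 * n₀ + 4 : ℕ) : ZMod (16 * n₀)))) ∨
       (n = 32 * n₀ ∧
          Xa.MoveEquiv m n k ℓ ((8 * n₀ + 1 : ℕ) : ZMod n) 4 ∧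
          Nonempty (Xa.graph m n k ℓ ≃g
            Xa.graph 4 (32 * n₀) ((8 * n₀ + 1 : ℕ) : ZMod (32 * n₀)) 4))) := by
  obtain ⟨hm4, hm, -, hne, hℓ, hkodd, ⟨h2, h2'⟩, -, hcond⟩ := hadm
  obtain ⟨rfl, hrel⟩ :=
    Xa.eq_four_of_hasTenCycleOfTypeThree hm4 hm (by omega) hne hkodd hℓ h3
  have hkℓ : ℓ * k = ℓ ∨ ℓ * k = -ℓ := by
    rcases hcond with h | ⟨-, h, -⟩
    · exact h.1
    · exact absurd h (by decide)
  obtain ⟨a, ha, he, hrel', hkℓ'⟩ :=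
    Xa.exists_stronglyEquiv hn hne hkodd hℓ h2 h2' hkℓ hk hrel
  have h8 : 8 * (a : ZMod n) = 0 := by
    rw [ha]; exact_mod_cast ZMod.natCast_self (8 * a)
  have : NeZero n := ⟨by omega⟩
  have key : ∃ L : ℤ, Xa.StronglyEquiv n k ℓ ((2 * a + 1 : ℕ) : ZMod n) (L : ZMod n) ∧
      (L = 4 * a ∨ L = 4 + 4 * a ∨ L = 4 ∨ a = 3 ∧ L = 6) := by
    obtain ⟨ℓ', hsign, hℓ'⟩ := hrel'.cases h8
    have he' : Xa.StronglyEquiv n k ℓ ((2 * a + 1 : ℕ) : ZMod n) ℓ' := by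
      rcases hsign with rfl | rfl
      · exact he
      · have := he.trans (Xa.stronglyEquiv_neg_right hne _ _)
        rwa [neg_neg] at this
    have hkℓ'' : ℓ' * (2 * (a : ZMod n) + 1) = ℓ' ∨ ℓ' * (2 * (a : ZMod n) + 1) = -ℓ' := by
      rcases hsign with rfl | rfl
      · exact hkℓ'
      · exact hkℓ'.imp (fun h => by linear_combination -h) (fun h => by linear_combination -h)
    have good (L : ℤ) (hL : L = 4 * a ∨ L = 4 + 4 * a ∨ L = 4 ∨ a = 3 ∧ L = 6)
        (hcast : ℓ' = (L : ZMod n)) : ∃ L : ℤ,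
        Xa.StronglyEquiv n k ℓ ((2 * a + 1 : ℕ) : ZMod n) (L : ZMod n) ∧
        (L = 4 * a ∨ L = 4 + 4 * a ∨ L = 4 ∨ a = 3 ∧ L = 6) :=
      ⟨L, hcast ▸ he', hL⟩
    have bad (L : ℤ) (hL : L = 2 ∨ L = 2 + 4 * a ∨ L = 6 ∨ L = 6 + 4 * a)
        (hcast : ℓ' = (L : ZMod n)) : ∃ L : ℤ,
        Xa.StronglyEquiv n k ℓ ((2 * a + 1 : ℕ) : ZMod n) (L : ZMod n) ∧
        (L = 4 * a ∨ L = 4 + 4 * a ∨ L = 4 ∨ a = 3 ∧ L = 6) := by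
      subst hcast
      subst ha
      obtain ⟨rfl, rfl | rfl⟩ := Xa.eq_three_of_mul_eq (by omega) hL hkℓ''
      · exact ⟨6, he', by simp⟩
      -- In `ℤ_24` one has `-18 = 6`.
      · exact ⟨6, he'.trans (Xa.stronglyEquiv_neg_right hne _ _), by simp⟩
    rcases hℓ' with h | h | h | h | h | h | h
    · exact good (4 * a) (by simp) (by push_cast; exact h)
    · exact good (4 + 4 * a) (by simp) (by push_cast; exact h)
    · exact good 4 (by simp) (by push_cast; exact h)
    · exact bad 2 (by simp) (by push_cast; exact h)
    · exact bad (2 + 4 * a) (by simp) (by push_cast; exact h)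
    · exact bad 6 (by simp) (by push_cast; exact h)
    · exact bad (6 + 4 * a) (by simp) (by push_cast; exact h)
  obtain ⟨L, hL, hL'⟩ := key
  obtain ⟨n₀, h1, ⟨rfl, hmove, e, -⟩ | ⟨rfl, hmove, e, -⟩⟩ :=
    Xa.conclusion_of_stronglyEquiv hn hC ha hL hL'
  · exact ⟨n₀, h1, rfl, .inl ⟨rfl, hmove, ⟨e⟩⟩⟩
  · exact ⟨n₀, h1, rfl, .inr ⟨rfl, hmove, ⟨e⟩⟩⟩
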